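/- **Model.** There are $n\ge 1$ binary cells, initially in state $0$; each cell can be programmed (have its state changed) at most $\ell$ times, and $t$ messages are written one after another, the $j$-th message being taken from $\{0,\dots,M_j-1\}$, $M_j\ge 1$. Let $v\in\{0,\dots,\ell\}^n$ be the program-count vector (how many times each cell was programmed so far; initially $v=0$); the state of cell $k$ is $v_k \bmod 2$. If a vector $c\in\{0,1\}^n$ is programmed when the count vector is $v$, the new count of cell $k$ is $v_k$ if $c_k\equiv v_k \pmod 2$ and $\min\{\ell,v_k+1\}$ otherwise. So a cell already programmed $\ell$ times does not change, and the new state of cell $k$ is $c_k$ if $v_k<\ell$ and $v_k\bmod 2$ if $v_k=\ell$. For $X,Y\in\{IA,IP,U\}$, an $\ell$-change $t$-write code in the model $EX{:}DY$ consists of deterministic encoding and decoding maps $\mathcal E_j,\mathcal D_j$, $1\le j\le t$. On write $j$, with count vector $v$ before the write, the encoder chooses the vector to be programmed from the message and from its information on $v$; the decoder estimates the message from the cell states after the write and from its information on $v$. The information is $v$ itself for $IA$, the state vector $v \bmod 2$ for $IP$, and nothing for $U$. If $X=IA$, it is moreover required that, at every count vector that can occur, the encoder never tries to change a cell already programmed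 $\ell$ times. The error probability of write $j$ is the probability that the $j$-th message is decoded wrongly when the messages are independent and uniformly distributed. A tuple $(R_1,\dots,R_t)$ of nonnegative reals is $\epsilon$-error achievable if for every $\epsilon>0$ there is a code (for some $n\geq 1$ and some $M_1,\dots,M_t$) all of whose $t$ error probabilities are at most $\epsilon$ and for which $\frac{\log_2 M_j}{n}\ge R_j-\epsilon$ for all $j$; it is zero-error achievable if, for every $\epsilon>0$, this holds with all error probabilities equal to $0$. For $g\in\{z,\epsilon\}$ (zero-error, $\epsilon$-error), the capacity region $\mathcal C^{EX:DY,g}_{t,\ell}$ is the set of all achievable tuples, and the maximum sum-rate $\mathcal R^{EX:DY,g}_{t,\ell}$ is the maximum of $R_1+\dots+R_t$ over this region. **Theorem.** Let $t>\ell\ge 3$. For every EIA model, that is, for every decoder information $Y\in\{IA,IP,U\}$ and each $g\in\{z,\epsilon\}$, the maxima $\mathcal R^{EIP:DIA,\epsilon}_{t,\ell}$ and $\mathcal R^{EIA:DY,g}_{t,\ell}$ exist, $$\mathcal R^{EIP:DIA,\epsilon}_{t,\ell}<\mathcal R^{EIA:DY,g}_{t,\ell},\qquad\text{and}\qquad \mathcal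 C^{EIP:DIA,\epsilon}_{t,\ell}\subsetneq \mathcal C^{EIA:DY,g}_{t,\ell}.$$ -/

import Mathlib

namespace ELM

/-- What an encoder or a decoder knows about the cells before a write: the number of times each
cell was programmed (`IA`, informed all), only the current state of each cell
(`IP`, informed partially), or nothing (`U`, uninformed). -/
inductive Info
  | IA
  | IP
  | U

/-- The zero-error case and the `ε`-error case. -/
inductive ErrorMode
  | zero
  | eps

/-- Cell-program-count vectors, the elements of `{0, …, ℓ}ⁿ`. -/
abbrev CountVec (n ℓ : ℕ) : Type := Fin n → Fin (ℓ + 1)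

/-- Cell-state vectors, the elements of `{0, 1}ⁿ`. -/
abbrev StateVec (n : ℕ) : Type := Fin n → Fin 2

/-- The cell-state vector `⟨v⟩₂` (`v` modulo 2) of a cell-program-count vector `v`. -/
def parity {n ℓ : ℕ} (v : CountVec n ℓ) : StateVec n :=
  fun k => ⟨(v k : ℕ) % 2, Nat.mod_lt _ Nat.two_pos⟩

/-- `N(v, c)`: the cell-program-count vector after programming the cell-state vector `c` into cells
with cell-program-count vector `v`; a cell already programmed `ℓ` times does not change. -/
def newCount {n ℓ : ℕ} (v : CountVec n ℓ) (c : StateVec n) : CountVec n ℓ :=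
  fun k => if c k = parity v k then v k
    else ⟨min ℓ ((v k : ℕ) + 1), Nat.lt_succ_of_le (min_le_left _ _)⟩

/-- `f(v, c)`: the cell-state vector after programming the cell-state vector `c` into cells with
cell-program-count vector `v`. -/
def newState {n ℓ : ℕ} (v : CountVec n ℓ) (c : StateVec n) : StateVec n :=
  fun k => if (v k : ℕ) < ℓ then c k else parity v k

/-- The type of the observation of a party with information `X`. -/
def Obs (n ℓ : ℕ) : Info → Type
  | Info.IA => CountVec n ℓ
  | Info.IP => StateVec n
  | Info.U => Unit

/-- What a party with information `X` sees when the cell-program-count vector is `v`. -/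
def observe {n ℓ : ℕ} : (X : Info) → CountVec n ℓ → Obs n ℓ X
  | Info.IA, v => v
  | Info.IP, v => parity v
  | Info.U, _ => ()

/-- The encoding maps of `t` writes with message sets of sizes `M j`. The write number `j + 1` is
indexed by `j : Fin t`. -/
abbrev Encoders (X : Info) (n t ℓ : ℕ) (M : Fin t → ℕ) : Type :=
  (j : Fin t) → Fin (M j) → Obs n ℓ X → StateVec n

/-- The decoding maps: the decoder sees the cell-state vector after the write and its observation of
the cell-program-count vector before the write. -/
abbrev Decoders (Y : Info) (n t ℓ : ℕ) (M : Fin t → ℕ) : Type :=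
  (j : Fin t) → StateVec n → Obs n ℓ Y → Fin (M j)

/-- The set of cell-program-count vectors that can be obtained after the first `j` writes. -/
def reachable {X : Info} {n t ℓ : ℕ} {M : Fin t → ℕ} (enc : Encoders X n t ℓ M) :
    ℕ → Set (CountVec n ℓ)
  | 0 => {fun _ => 0}
  | j + 1 => {w | ∃ (h : j < t) (m : Fin (M ⟨j, h⟩)), ∃ v ∈ reachable enc j,
      w = newCount v (enc ⟨j, h⟩ m (observe X v))}

open Classical in
/-- `Pr(v)`: the probability that the cell-program-count vector after the first `j` writes is `v`,
when the messages are independent and uniformly distributed. -/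
noncomputable def countProb {X : Info} {n t ℓ : ℕ} {M : Fin t → ℕ} (enc : Encoders X n t ℓ M) :
    ℕ → CountVec n ℓ → ℝ
  | 0, w => if w = (fun _ => 0) then 1 else 0
  | j + 1, w =>
      if h : j < t then
        ∑ m : Fin (M ⟨j, h⟩), ∑ v : CountVec n ℓ,
          if newCount v (enc ⟨j, h⟩ m (observe X v)) = w
            then 1 / (M ⟨j, h⟩ : ℝ) * countProb enc j v else 0
      else 0

/-- An `ℓ`-change `t`-write endurance-limited memory code on `n` cells in the model `EX:DY`, with
message sets of sizes `M j` (which are nonempty, since the decoding maps take values in them). In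
the models with a fully informed encoder, the encoder never programs a cell that was already
programmed `ℓ` times (the sum inside the cast is addition modulo 2). -/
structure Code (X Y : Info) (n t ℓ : ℕ) (M : Fin t → ℕ) where
  enc : Encoders X n t ℓ M
  dec : Decoders Y n t ℓ M
  admissible : X = Info.IA → ∀ (j : Fin t) (m : Fin (M j)), ∀ v ∈ reachable enc j, ∀ k : Fin n,
    (v k : ℕ) + ((parity v k + enc j m (observe X v) k : Fin 2) : ℕ) ≤ ℓ

open Classical in
/-- The probability that the message of the write indexed by `j` is decoded wrongly: the sum over
all messages `m` and count vectors `v` before the write of `Pr(m) Pr(v)` times the indicator of a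
wrong decoding. -/
noncomputable def Code.errorProb {X Y : Info} {n t ℓ : ℕ} {M : Fin t → ℕ} (C : Code X Y n t ℓ M)
    (j : Fin t) : ℝ :=
  ∑ m : Fin (M j), ∑ v : CountVec n ℓ,
    1 / (M j : ℝ) * countProb C.enc j v *
      (if C.dec j (newState v (C.enc j m (observe X v))) (observe Y v) = m then 0 else 1)

/-- The largest error probability that is allowed when the tolerance is `ε`. -/
def allowedError : ErrorMode → ℝ → ℝ
  | ErrorMode.zero, _ => 0
  | ErrorMode.eps, ε => ε

/-- The rate tuple `R` is (zero-error or `ε`-error) achievable in the model `EX:DY`. -/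
def Achievable (X Y : Info) (g : ErrorMode) (t ℓ : ℕ) (R : Fin t → ℝ) : Prop :=
  ∀ ε : ℝ, 0 < ε → ∃ (n : ℕ) (M : Fin t → ℕ) (C : Code X Y n t ℓ M), 0 < n ∧
    ∀ j : Fin t, C.errorProb j ≤ allowedError g ε ∧ R j - ε ≤ Real.logb 2 (M j) / n

/-- The capacity region of the model `EX:DY`: the set of all achievable rate tuples. -/
def capacityRegion (X Y : Info) (g : ErrorMode) (t ℓ : ℕ) : Set (Fin t → ℝ) :=
  {R | (∀ j, 0 ≤ R j) ∧ Achievable X Y g t ℓ R}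

/-- The sum-rates of all tuples in the capacity region. -/
def sumRates (X Y : Info) (g : ErrorMode) (t ℓ : ℕ) : Set ℝ :=
  (fun R : Fin t → ℝ => ∑ j, R j) '' capacityRegion X Y g t ℓ

/-- The maximum sum-rate of the model `EX:DY`. -/
noncomputable def maxSumRate (X Y : Info) (g : ErrorMode) (t ℓ : ℕ) : ℝ :=
  sSup (sumRates X Y g t ℓ)

end ELM

open Filter Topology

namespace ELM

variable {n t ℓ : ℕ}

/-! A reliable code yields a tree: sets `G j` of count vectors, with `0` in `G 0`, such that each
vector in `G j` has almost `M j` successors in `G (j + 1)`. Conversely, a tree gives a zero-error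
code for an informed encoder and an uninformed decoder (`IsTree.exists_code`): in a suitable
colouring of the state vectors by messages, every message occurs among the successors of every
vector of the tree. The loss is a factor linear in the number of cells, and it vanishes from the
rate when the tree is replaced by its powers. This gives the inclusion of the regions, and it
reduces lower bounds for all EIA models to the weakest one.

For strictness, let `W = ways t 0` be the number of count histories of one cell. By pigeonhole, the
`W ^ n` histories of `n` cells contain a tree with uniform degrees whose product is `W ^ n` up to a
polynomial factor (`exists_isTree`), so an informed encoder has sum-rates arbitrarily close to `log₂
W`.

A partially informed encoder loses in the last two writes. Counts `ℓ - 1` and `ℓ - 3` have the same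
state and both can be programmed, so it must treat such cells alike, although they have 3 and 4
continuations. Since the last message set has the same size in both situations, geometric means
apply (`Code.mul_le_prod_pairWays`) and give `(2 + √2)² < 3 * 4` for such a pair of cells. Summing
over pairs of count vectors that agree after merging the two counts (`sum_mul_le_of_pairWays`)
bounds the product of the message numbers, up to factors close to 1, by `L ^ n` with `L < W`. As `t
> ℓ ≥ 3`, both counts do occur after `t - 2` writes. -/

/-! ### Admissible writes and count histories -/

/-- One write changes the count of a cell from `i` to `i'`. -/
def CellStep (i i' : Fin (ℓ + 1)) : Prop := (i' : ℕ) = i ∨ (i' : ℕ) = i + 1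

instance (i i' : Fin (ℓ + 1)) : Decidable (CellStep i i') :=
  inferInstanceAs (Decidable ((i' : ℕ) = i ∨ (i' : ℕ) = i + 1))

/-- One admissible write changes the count vector from `v` to `w`. -/
def Step (v w : CountVec n ℓ) : Prop := ∀ k, CellStep (v k) (w k)

instance (v w : CountVec n ℓ) : Decidable (Step v w) :=
  inferInstanceAs (Decidable (∀ k, CellStep (v k) (w k)))

/-- The number of count histories of one cell over `r` writes that start at `i`. -/
def ways : ℕ → Fin (ℓ + 1) → ℕ
  | 0, _ => 1
  | r + 1, i => ∑ i', if CellStep i i' then ways r i' else 0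

/-- The number of count histories of one cell over `j` writes that lead from `0` to `i`. -/
def arrivals : ℕ → Fin (ℓ + 1) → ℕ
  | 0, i => if i = 0 then 1 else 0
  | j + 1, i => ∑ i', if CellStep i' i then arrivals j i' else 0

/-- Every history is cut after `j` writes. The induction moves the cut by one write, which only
exchanges two sums. -/
theorem sum_arrivals_mul_ways (j r : ℕ) :
    ∑ i : Fin (ℓ + 1), arrivals j i * ways r i = ways (j + r) (0 : Fin (ℓ + 1)) := by
  induction j generalizing r with
  | zero => simp [arrivals]
  | succ j ih =>
    rw [show j + 1 + r = j + (r + 1) by omega, ← ih]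
    simp only [arrivals, ways, Finset.sum_mul, Finset.mul_sum]
    rw [Finset.sum_comm]
    refine Finset.sum_congr rfl fun i _ => Finset.sum_congr rfl fun i' _ => ?_
    split_ifs <;> simp

theorem sum_prod_ite {R : Type*} [CommSemiring R] {ι α : Type*} [Fintype ι] [DecidableEq ι]
    [Fintype α]
    (P : ι → α → Prop) [∀ k, DecidablePred (P k)] [DecidablePred fun w : ι → α => ∀ k, P k (w k)]
    (f : ι → α → R) :
    ∑ w : ι → α, (if ∀ k, P k (w k) then ∏ k, f k (w k) else 0)
      = ∏ k, ∑ a, if P k a then f k a else 0 := by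
  rw [Finset.prod_univ_sum, Fintype.piFinset_univ]
  refine Finset.sum_congr rfl fun w _ => ?_
  rw [Finset.prod_ite_zero]
  simp

theorem parity_val (v : CountVec n ℓ) (k : Fin n) : ((parity v k : Fin 2) : ℕ) = (v k : ℕ) % 2 :=
  rfl

theorem newState_eq_parity (v : CountVec n ℓ) (c : StateVec n) :
    newState v c = parity (newCount v c) := by
  funext k
  apply Fin.ext
  rw [parity_val]
  have hc := (c k).isLt
  have hv := (v k).isLt
  unfold newState newCount
  by_cases h : c k = parity v k
  · rw [if_pos h]
    have := congrArg Fin.val h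
    rw [parity_val] at this
    split_ifs
    · omega
    · exact parity_val v k
  · rw [if_neg h]
    have : (c k : ℕ) ≠ (v k : ℕ) % 2 := fun e => h (Fin.ext e)
    split_ifs with h1
    · simp only; omega
    · rw [parity_val]; simp only; omega

theorem step_newCount (v : CountVec n ℓ) (c : StateVec n) : Step v (newCount v c) := by
  intro k
  unfold newCount CellStep
  have := (v k).isLt
  split_ifs
  · exact Or.inl rfl
  · simp only; omega

theorem newCount_parity {v w : CountVec n ℓ} (h : Step v w) : newCount v (parity w) = w := by
  funext k
  apply Fin.ext
  have hw := (w k).isLt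
  unfold newCount
  rcases h k with h | h
  · rw [if_pos, h]
    apply Fin.ext
    rw [parity_val, parity_val, h]
  · rw [if_neg]
    · simp only; omega
    · intro e
      have := congrArg Fin.val e
      rw [parity_val, parity_val] at this
      omega

/-- An admissible write adds 0 or 1 to each count, so the new states together with `v` determine the
new counts. Hence state vectors can stand for successors without loss. -/
theorem parity_injOn (v : CountVec n ℓ) : Set.InjOn parity {w | Step v w} := by
  intro w hw w' hw' h
  rw [← newCount_parity hw, ← newCount_parity hw', h]

/-! ### From codes with small error to trees -/

/-- The message `m` of the write indexed by `j` is decoded correctly if the count vector before the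
write is `v` and known to the decoder. -/
def Code.Correct {X : Info} {M : Fin t → ℕ} (C : Code X Info.IA n t ℓ M) (j : Fin t) (m : Fin (M j))
    (v : CountVec n ℓ) : Prop :=
  C.dec j (newState v (C.enc j m (observe X v))) v = m

/-- The count vector after the message `m` is written on cells with count vector `v`. -/
def Code.next {X Y : Info} {M : Fin t → ℕ} (C : Code X Y n t ℓ M) (j : Fin t) (m : Fin (M j))
    (v : CountVec n ℓ) : CountVec n ℓ :=
  newCount v (C.enc j m (observe X v))

theorem Code.next_injOn {X : Info} {M : Fin t → ℕ} (C : Code X Info.IA n t ℓ M) (j : Fin t)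
    (v : CountVec n ℓ) : Set.InjOn (fun m => C.next j m v) {m | C.Correct j m v} := by
  intro m hm m' hm' h
  have h1 : C.dec j (parity (C.next j m v)) v = m := by
    rw [Code.next, ← newState_eq_parity]; exact hm
  have h2 : C.dec j (parity (C.next j m' v)) v = m' := by
    rw [Code.next, ← newState_eq_parity]; exact hm'
  rw [← h1, ← h2]
  simp only at h
  rw [h]

theorem Code.pos {X Y : Info} {M : Fin t → ℕ} (C : Code X Y n t ℓ M) (j : Fin t) : 0 < M j :=
  Fin.pos (C.dec j (fun _ => 0) (observe Y fun _ => 0))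

theorem countProb_nonneg {X : Info} {M : Fin t → ℕ} (enc : Encoders X n t ℓ M) (j : ℕ)
    (w : CountVec n ℓ) : 0 ≤ countProb enc j w := by
  induction j generalizing w with
  | zero => unfold countProb; split_ifs <;> norm_num
  | succ j ih =>
    unfold countProb
    split_ifs with h
    · refine Finset.sum_nonneg fun m _ => Finset.sum_nonneg fun v _ => ?_
      split_ifs
      · exact mul_nonneg (by positivity) (ih v)
      · exact le_rfl
    · exact le_rfl

theorem sum_countProb_succ {X Y : Info} {M : Fin t → ℕ} (C : Code X Y n t ℓ M) (j : Fin t)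
    (f : CountVec n ℓ → ℝ) :
    ∑ w, countProb C.enc (j + 1) w * f w
      = ∑ v, countProb C.enc j v * ∑ m, 1 / (M j : ℝ) * f (C.next j m v) := by
  classical
  simp only [countProb, j.isLt, dif_pos, Fin.eta, Finset.mul_sum, Finset.sum_mul]
  rw [Finset.sum_comm]
  have : ∀ m : Fin (M j), ∑ w : CountVec n ℓ, ∑ v : CountVec n ℓ,
      (if newCount v (C.enc j m (observe X v)) = w
        then 1 / (M j : ℝ) * countProb C.enc j v else 0) * f w
      = ∑ v, countProb C.enc j v * (1 / (M j : ℝ) * f (C.next j m v)) := by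
    intro m
    rw [Finset.sum_comm]
    refine Finset.sum_congr rfl fun v _ => ?_
    simp only [ite_mul, zero_mul]
    rw [Finset.sum_ite_eq]
    simp only [Finset.mem_univ, if_true, Code.next]
    ring
  rw [Finset.sum_congr rfl fun m _ => this m, Finset.sum_comm]

open Classical in
/-- If the error probabilities are small, then there are sets of count vectors such that in each
of them almost all messages are decoded correctly and lead into the next set. -/
theorem Code.exists_good {X : Info} {M : Fin t → ℕ} (C : Code X Info.IA n t ℓ M) {η ε : ℝ}
    (hη : 0 < η) (hη1 : η ≤ 1) (hε : t * ε < η ^ t) (herr : ∀ j, C.errorProb j ≤ ε) :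
    ∃ G : ℕ → Set (CountVec n ℓ), (fun _ => 0) ∈ G 0 ∧ ∀ j : Fin t, ∀ v ∈ G j,
      (1 - η) * M j ≤
        (Finset.univ.filter fun m => C.Correct j m v ∧ C.next j m v ∈ G (j + 1)).card := by
  -- Backward induction over the writes: the probability of lying outside the good set before the
  -- last `r` writes is at most `r * ε / η ^ r`, each write costing one factor `η` by Markov's
  -- inequality.
  have key : ∀ r ≤ t, ∃ G : ℕ → Set (CountVec n ℓ), (∀ j : Fin t, t - r ≤ j → ∀ v ∈ G j,
      (1 - η) * M j ≤
        (Finset.univ.filter fun m => C.Correct j m v ∧ C.next j m v ∈ G (j + 1)).card) ∧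
      η ^ r * ∑ v, countProb C.enc (t - r) v * (if v ∈ G (t - r) then 0 else 1) ≤ r * ε := by
    intro r
    induction r with
    | zero =>
      intro _
      refine ⟨fun _ => Set.univ, fun j hj => ?_, by simp⟩
      have := j.isLt
      omega
    | succ r ih =>
      intro hr
      obtain ⟨G, hG, hbad⟩ := ih (by omega)
      obtain ⟨j, hj⟩ : ∃ j : Fin t, (j : ℕ) = t - (r + 1) := ⟨⟨t - (r + 1), by omega⟩, rfl⟩
      have hj1 : t - r = (j : ℕ) + 1 := by omega
      rw [hj1] at hG hbad
      rw [← hj]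
      refine ⟨Function.update G j {v | (1 - η) * M j ≤ (Finset.univ.filter fun m =>
        C.Correct j m v ∧ C.next j m v ∈ G (j + 1)).card}, ?_, ?_⟩
      · intro i hi v hv
        rw [Function.update_of_ne (by omega)]
        rcases eq_or_ne i j with rfl | hne
        · simpa using hv
        · have hne' : (i : ℕ) ≠ j := fun h => hne (Fin.ext h)
          rw [Function.update_of_ne hne'] at hv
          exact hG i (by omega) v hv
      · rw [Function.update_self]
        rw [sum_countProb_succ] at hbad
        have hM : (0 : ℝ) < M j := by exact_mod_cast C.pos j
        have herrj : C.errorProb j = ∑ v, countProb C.enc j v *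
            ∑ m, 1 / (M j : ℝ) * (if C.Correct j m v then 0 else 1) := by
          unfold Code.errorProb
          rw [Finset.sum_comm]
          refine Finset.sum_congr rfl fun v _ => ?_
          rw [Finset.mul_sum]
          refine Finset.sum_congr rfl fun m _ => ?_
          unfold Code.Correct
          have : observe Info.IA v = v := rfl
          rw [this]
          ring_nf
        -- Markov's inequality: outside the new good set, more than a fraction `η` of the messages
        -- is decoded wrongly or leads out of the next good set.
        have hmain : η * ∑ v, countProb C.enc j v * (if (1 - η) * M j ≤
            (Finset.univ.filter fun m => C.Correct j m v ∧ C.next j m v ∈ G (j + 1)).card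
              then 0 else 1) ≤ C.errorProb j + ∑ v, countProb C.enc j v *
                ∑ m, 1 / (M j : ℝ) * (if C.next j m v ∈ G (j + 1) then 0 else 1) := by
          rw [herrj, ← Finset.sum_add_distrib, Finset.mul_sum]
          refine Finset.sum_le_sum fun v _ => ?_
          rw [← mul_add, mul_left_comm]
          refine mul_le_mul_of_nonneg_left ?_ (countProb_nonneg _ _ _)
          rw [← Finset.sum_add_distrib]
          simp only [← mul_add]
          rw [← Finset.mul_sum]
          split_ifs with hc
          · rw [mul_zero]
            refine mul_nonneg (by positivity) (Finset.sum_nonneg fun m _ => ?_)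
            split_ifs <;> norm_num
          · rw [mul_one, one_div, inv_mul_eq_div, le_div_iff₀ hM]
            have h1 : (M j : ℝ) - (Finset.univ.filter fun m =>
                C.Correct j m v ∧ C.next j m v ∈ G (j + 1)).card ≤
                ∑ m, ((if C.Correct j m v then 0 else 1 : ℝ) +
                  (if C.next j m v ∈ G (j + 1) then 0 else 1)) := by
              have : (M j : ℝ) = ∑ m : Fin (M j), (1 : ℝ) := by simp
              rw [this, Finset.card_filter, Nat.cast_sum, ← Finset.sum_sub_distrib]
              refine Finset.sum_le_sum fun m _ => ?_
              by_cases h1 : C.Correct j m v <;> by_cases h2 : C.next j m v ∈ G (j + 1) <;>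
                simp [h1, h2]
            push Not at hc
            linarith
        have hp : (0 : ℝ) ≤ η ^ r := by positivity
        have hp1 : η ^ r ≤ 1 := pow_le_one₀ hη.le hη1
        have h0 : 0 ≤ C.errorProb j := by
          rw [herrj]
          refine Finset.sum_nonneg fun v _ => mul_nonneg (countProb_nonneg _ _ _) <|
            Finset.sum_nonneg fun m _ => ?_
          split_ifs <;> simp
        calc _ = η ^ r * (η * ∑ v, countProb C.enc j v * (if (1 - η) * M j ≤
            (Finset.univ.filter fun m => C.Correct j m v ∧ C.next j m v ∈ G (j + 1)).card
              then 0 else 1)) := by rw [pow_succ, mul_assoc]; rfl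
          _ ≤ η ^ r * (C.errorProb j + ∑ v, countProb C.enc j v *
                ∑ m, 1 / (M j : ℝ) * (if C.next j m v ∈ G (j + 1) then 0 else 1)) :=
              mul_le_mul_of_nonneg_left hmain hp
          _ = η ^ r * C.errorProb j + η ^ r * ∑ v, countProb C.enc j v *
                ∑ m, 1 / (M j : ℝ) * (if C.next j m v ∈ G (j + 1) then 0 else 1) := mul_add _ _ _
          _ ≤ 1 * ε + r * ε := add_le_add
              (mul_le_mul hp1 (herr j) h0 zero_le_one) hbad
          _ = ((r + 1 : ℕ) : ℝ) * ε := by push_cast; ring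
  obtain ⟨G, hG, hbad⟩ := key t le_rfl
  rw [Nat.sub_self] at hG hbad
  refine ⟨G, ?_, fun j => hG j (Nat.zero_le _)⟩
  -- The initial distribution is concentrated at `0`, so if `0` were bad, the bad probability would
  -- be 1, against `t * ε < η ^ t`.
  by_contra hn
  have : ∑ v : CountVec n ℓ, countProb C.enc 0 v * (if v ∈ G 0 then 0 else 1) = 1 := by
    rw [Finset.sum_eq_single (fun _ => 0)]
    · simp [countProb, hn]
    · intro v _ hv
      simp [countProb, hv]
    · simp
  rw [this, mul_one] at hbad
  linarith

open Classical in
/-- The vectors in `S` that can be obtained from `v` by one admissible write. -/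
noncomputable def successors (S : Set (CountVec n ℓ)) (v : CountVec n ℓ) : Finset (CountVec n ℓ) :=
  Finset.univ.filter fun w => w ∈ S ∧ Step v w

theorem mem_successors {S : Set (CountVec n ℓ)} {v w : CountVec n ℓ} :
    w ∈ successors S v ↔ w ∈ S ∧ Step v w := by
  simp [successors]

theorem card_successors_le (S : Set (CountVec n ℓ)) (v : CountVec n ℓ) :
    (successors S v).card ≤ 2 ^ n := by
  classical
  rw [← Finset.card_image_of_injOn
    ((parity_injOn v).mono fun w (hw : w ∈ successors S v) => (mem_successors.1 hw).2)]
  have h := Finset.card_le_univ ((successors S v).image parity)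
  have h' : Fintype.card (StateVec n) = 2 ^ n := by simp
  rwa [h'] at h

/-- A sequence of sets of count vectors, beginning with a set that contains `0`, such that before
the write indexed by `j` each vector of the current set can be changed into at least `D j` vectors
of the next set. -/
def IsTree (D : Fin t → ℝ) (G : ℕ → Set (CountVec n ℓ)) : Prop :=
  (fun _ => 0) ∈ G 0 ∧ ∀ j : Fin t, ∀ v ∈ G j, D j ≤ (successors (G (j + 1)) v).card

theorem Code.exists_isTree {X : Info} {M : Fin t → ℕ} (C : Code X Info.IA n t ℓ M) {η ε : ℝ}
    (hη : 0 < η) (hη1 : η ≤ 1) (hε : t * ε < η ^ t) (herr : ∀ j, C.errorProb j ≤ ε) :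
    ∃ G : ℕ → Set (CountVec n ℓ), IsTree (fun j => (1 - η) * M j) G := by
  classical
  obtain ⟨G, h0, hG⟩ := C.exists_good hη hη1 hε herr
  refine ⟨G, h0, fun j v hv => (hG j v hv).trans ?_⟩
  rw [Nat.cast_le]
  refine Finset.card_le_card_of_injOn (fun m => C.next j m v) (fun m hm => ?_) ?_
  · simp only [Finset.coe_filter, Finset.mem_univ, true_and, Set.mem_ofPred_eq] at hm
    exact mem_successors.2 ⟨hm.2, step_newCount _ _⟩
  · refine (C.next_injOn j v).mono fun m hm => ?_
    simp only [Finset.coe_filter, Finset.mem_univ, true_and, Set.mem_ofPred_eq] at hm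
    exact hm.1

/-- The `N`-fold product of a tree. -/
theorem IsTree.exists_pow {D : Fin t → ℝ} {G : ℕ → Set (CountVec n ℓ)} (hG : IsTree D G)
    (hD : ∀ j, 0 ≤ D j) (N : ℕ) :
    ∃ G' : ℕ → Set (CountVec (N * n) ℓ), IsTree (fun j => D j ^ N) G' := by
  classical
  refine ⟨fun j => {v | ∀ a : Fin N, (fun k => v (finProdFinEquiv (a, k))) ∈ G j},
    fun _ => hG.1, fun j v hv => ?_⟩
  calc D j ^ N = ∏ _a : Fin N, D j := by simp
    _ ≤ ∏ a : Fin N, ((successors (G (j + 1)) fun k => v (finProdFinEquiv (a, k))).card : ℝ) :=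
      Finset.prod_le_prod (fun _ _ => hD j) fun a _ => hG.2 j _ (hv a)
    _ = ((Fintype.piFinset fun a : Fin N =>
          successors (G (j + 1)) fun k => v (finProdFinEquiv (a, k))).card : ℝ) := by
      rw [Fintype.card_piFinset, Nat.cast_prod]
    _ ≤ _ := by
      rw [Nat.cast_le]
      refine Finset.card_le_card_of_injOn
        (fun x k => x (finProdFinEquiv.symm k).1 (finProdFinEquiv.symm k).2) (fun x hx => ?_) ?_
      · rw [Finset.mem_coe, Fintype.mem_piFinset] at hx
        refine mem_successors.2 ⟨fun a => ?_, fun k => ?_⟩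
        · simpa using (mem_successors.1 (hx a)).1
        · have := (mem_successors.1 (hx (finProdFinEquiv.symm k).1)).2 (finProdFinEquiv.symm k).2
          simp only [Prod.mk.eta, Equiv.apply_symm_apply] at this
          exact this
      · intro x _ y _ h
        funext a k
        simpa using congrFun h (finProdFinEquiv (a, k))

/-! ### From trees to zero-error codes by colouring -/

/-- If `K` is large, the elements of `Ω` can be coloured with `m` colours such that each of the sets
`S v`, of size at least `K`, contains all colours. -/
theorem exists_colouring {Ω V : Type*} [Fintype Ω] [DecidableEq Ω] [Fintype V] (S : V → Finset Ω)
    (m K : ℕ) (hS : ∀ v, K ≤ (S v).card) (hm : 0 < m)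
    (hK : (Fintype.card V * m : ℝ) < Real.exp (K / m)) :
    ∃ f : Ω → Fin m, ∀ v c, ∃ x ∈ S v, f x = c := by
  classical
  by_contra! hcon
  have hm' : (0 : ℝ) < m := by exact_mod_cast hm
  -- Union bound over the pairs of a set and a colour missing from it: a proportion at most `(1 - 1
  -- / m) ^ K ≤ exp (-K / m)` of all colourings is bad for a given pair.
  let bad : V × Fin m → Finset (Ω → Fin m) := fun p =>
    Fintype.piFinset fun x => if x ∈ S p.1 then Finset.univ.erase p.2 else Finset.univ
  have hcover : (Finset.univ : Finset (Ω → Fin m)) ⊆ Finset.univ.biUnion bad := by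
    intro f _
    obtain ⟨v, c, h⟩ := hcon f
    refine Finset.mem_biUnion.2 ⟨(v, c), Finset.mem_univ _, Fintype.mem_piFinset.2 fun x => ?_⟩
    by_cases hx : x ∈ S v
    · simp [hx, h x hx]
    · simp [hx]
  have h1m : (0 : ℝ) ≤ 1 - 1 / m := by
    rw [sub_nonneg, div_le_one hm']
    exact_mod_cast hm
  have hbad : ∀ p, ((bad p).card : ℝ) ≤ (m : ℝ) ^ Fintype.card Ω * Real.exp (-(K / m)) := by
    intro p
    have : ((bad p).card : ℝ) = ∏ x : Ω, (m * if x ∈ S p.1 then (1 - 1 / m : ℝ) else 1) := by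
      rw [Fintype.card_piFinset, Nat.cast_prod]
      refine Finset.prod_congr rfl fun x _ => ?_
      split_ifs
      · rw [Finset.card_erase_of_mem (Finset.mem_univ _), Finset.card_univ, Fintype.card_fin,
          Nat.cast_sub hm]
        field_simp
        simp
      · simp
    rw [this, Finset.prod_mul_distrib]
    rw [Finset.prod_const, Finset.card_univ, Finset.prod_ite_mem, Finset.univ_inter,
      Finset.prod_const]
    refine mul_le_mul_of_nonneg_left ?_ (by positivity)
    calc (1 - 1 / m : ℝ) ^ (S p.1).card ≤ (1 - 1 / m : ℝ) ^ K :=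
          pow_le_pow_of_le_one h1m (by simp) (hS _)
      _ ≤ Real.exp (-(1 / m)) ^ K :=
          pow_le_pow_left₀ h1m (by have := Real.add_one_le_exp (-(1 / m : ℝ)); linarith) _
      _ = _ := by rw [← Real.exp_nat_mul]; congr 1; ring
  have hcount := (Finset.card_le_card hcover).trans Finset.card_biUnion_le
  rw [Finset.card_univ, Fintype.card_fun, Fintype.card_fin] at hcount
  have hcount' : (m : ℝ) ^ Fintype.card Ω ≤ ∑ p, ((bad p).card : ℝ) := by exact_mod_cast hcount
  have h2 := hcount'.trans (Finset.sum_le_sum fun p _ => hbad p)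
  rw [Finset.sum_const, Finset.card_univ, Fintype.card_prod, Fintype.card_fin, nsmul_eq_mul,
    Nat.cast_mul, mul_left_comm] at h2
  have hpos : (0 : ℝ) < (m : ℝ) ^ Fintype.card Ω := by positivity
  have h3 : (1 : ℝ) ≤ Fintype.card V * m * Real.exp (-(K / m)) := by
    by_contra! hlt
    have := mul_lt_mul_of_pos_left hlt hpos
    linarith
  rw [Real.exp_neg, ← div_eq_mul_inv, le_div_iff₀ (Real.exp_pos _)] at h3
  linarith

/-- A tree gives a zero-error code with an uninformed decoder. -/
theorem IsTree.exists_code {D : Fin t → ℝ} {G : ℕ → Set (CountVec n ℓ)} (hG : IsTree D G)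
    (hD : ∀ j, 0 < D j) (hn : 0 < n) :
    ∃ (M : Fin t → ℕ) (C : Code Info.IA Info.U n t ℓ M), (∀ j, C.errorProb j = 0) ∧
      ∀ j, D j / (4 * (ℓ + 1) * n) ≤ M j := by
  classical
  have hn' : (1 : ℝ) ≤ n := by exact_mod_cast hn
  have hc : (0 : ℝ) < 2 * (ℓ + 1) * n := by positivity
  have hM : ∀ j, ∃ m : ℕ, 0 < m ∧ D j / (4 * (ℓ + 1) * n) ≤ m ∧
      ∃ f : StateVec n → Fin m, ∀ v ∈ G j, ∀ c, ∃ w ∈ successors (G (j + 1)) v,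
        f (parity w) = c := by
    intro j
    -- For small degree one message suffices, and a positive degree still provides a successor.
    rcases lt_or_ge (D j) (2 * (ℓ + 1) * n) with hlt | hge
    · refine ⟨1, one_pos, ?_, fun _ => 0, fun v hv c => ?_⟩
      · rw [Nat.cast_one, div_le_one (by positivity)]
        linarith
      · have := (hD j).trans_le (hG.2 j v hv)
        obtain ⟨w, hw⟩ := Finset.card_pos.1 (by exact_mod_cast this)
        exact ⟨w, hw, Subsingleton.elim _ _⟩
    · set x := D j / (2 * (ℓ + 1) * n) with hx
      have hx1 : 1 ≤ x := by rwa [hx, le_div_iff₀ hc, one_mul]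
      have hm : 0 < ⌊x⌋₊ := Nat.floor_pos.2 hx1
      have hm' : (0 : ℝ) < ⌊x⌋₊ := by exact_mod_cast hm
      refine ⟨⌊x⌋₊, hm, ?_, ?_⟩
      · have h1 := Nat.lt_floor_add_one x
        have h2 : (1 : ℝ) ≤ ⌊x⌋₊ := by exact_mod_cast hm
        have h3 : D j / (4 * (ℓ + 1) * n) = x / 2 := by rw [hx]; field_simp; norm_num
        rw [h3]
        linarith
      · set K := ⌈D j⌉₊ with hKdef
        have hDK : D j ≤ K := Nat.le_ceil _
        have hcard : ∀ v : CountVec n ℓ, ((successors (G (j + 1)) v).image parity).card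
            = (successors (G (j + 1)) v).card := fun v =>
          Finset.card_image_of_injOn ((parity_injOn v).mono fun w hw => (mem_successors.1 hw).2)
        by_cases hne : (G j).Nonempty
        swap
        · exact ⟨fun _ => ⟨0, hm⟩, fun v hv => (hne ⟨v, hv⟩).elim⟩
        obtain ⟨f, hf⟩ := exists_colouring
          (fun v : {v // v ∈ G j} => (successors (G (j + 1)) v.1).image parity) ⌊x⌋₊ K
          (fun v => by rw [hcard, hKdef, Nat.ceil_le]; exact hG.2 j v.1 v.2) hm (by
            have hV : (Fintype.card {v // v ∈ G j} : ℝ) ≤ (ℓ + 1 : ℝ) ^ n := by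
              have := Fintype.card_subtype_le fun v : CountVec n ℓ => v ∈ G j
              have h2 : Fintype.card (CountVec n ℓ) = (ℓ + 1) ^ n := by simp
              rw [h2] at this
              exact_mod_cast this
            have hfl : (⌊x⌋₊ : ℝ) ≤ 2 ^ n := by
              obtain ⟨v, hv⟩ := hne
              have h1 := hG.2 j v hv
              have h2 : ((successors (G (j + 1)) v).card : ℝ) ≤ 2 ^ n := by
                exact_mod_cast card_successors_le _ v
              have h4 : x ≤ D j := by
                rw [hx]
                refine div_le_self (hD j).le ?_
                have : (0 : ℝ) ≤ ℓ := by positivity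
                nlinarith
              linarith [Nat.floor_le (zero_le_one.trans hx1)]
            have hlog : (2 * (ℓ + 1) : ℝ) < Real.exp (2 * (ℓ + 1)) := by
              have := Real.add_one_le_exp (2 * (ℓ + 1) : ℝ)
              linarith
            calc (Fintype.card {v // v ∈ G j} * ⌊x⌋₊ : ℝ) ≤ (ℓ + 1 : ℝ) ^ n * 2 ^ n :=
                  mul_le_mul hV hfl hm'.le (by positivity)
              _ = (2 * (ℓ + 1) : ℝ) ^ n := by rw [← mul_pow]; ring
              _ < Real.exp (2 * (ℓ + 1)) ^ n := pow_lt_pow_left₀ hlog (by positivity) hn.ne'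
              _ = Real.exp (2 * (ℓ + 1) * n) := by rw [← Real.exp_nat_mul]; congr 1; ring
              _ ≤ Real.exp (K / ⌊x⌋₊) := by
                rw [Real.exp_le_exp, le_div_iff₀ hm']
                have := Nat.floor_le (zero_le_one.trans hx1)
                rw [hx, le_div_iff₀ hc] at this
                linarith)
        refine ⟨f, fun v hv c => ?_⟩
        obtain ⟨s, hs, hfs⟩ := hf ⟨v, hv⟩ c
        obtain ⟨w, hw, rfl⟩ := Finset.mem_image.1 hs
        exact ⟨w, hw, hfs⟩
  choose M hMpos hMD f hf using hM
  -- The encoder moves to a successor in the tree whose state vector has the colour `m`. Outside the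
  -- tree its value is irrelevant, since such vectors are never reached.
  have henc : ∀ j (m : Fin (M j)) (v : CountVec n ℓ), ∃ c : StateVec n, v ∈ G j →
      ∃ w ∈ successors (G (j + 1)) v, c = parity w ∧ f j (parity w) = m := by
    intro j m v
    by_cases hv : v ∈ G j
    · obtain ⟨w, hw, h⟩ := hf j v hv m
      exact ⟨parity w, fun _ => ⟨w, hw, rfl, h⟩⟩
    · exact ⟨fun _ => 0, fun h => (hv h).elim⟩
  choose enc henc using henc
  let E : Encoders Info.IA n t ℓ M := enc
  have hreach : ∀ j ≤ t, ∀ v ∈ reachable E j, v ∈ G j := by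
    intro j
    induction j with
    | zero =>
      intro _ v hv
      rw [show v = fun _ => 0 from hv]
      exact hG.1
    | succ j ih =>
      rintro hj _ ⟨h, m, v, hv, rfl⟩
      obtain ⟨w, hw, hc, -⟩ := henc ⟨j, h⟩ m v (ih (by omega) v hv)
      have : E ⟨j, h⟩ m (observe Info.IA v) = parity w := hc
      rw [this, newCount_parity (mem_successors.1 hw).2]
      exact (mem_successors.1 hw).1
  have hprob : ∀ j ≤ t, ∀ v, v ∉ G j → countProb E j v = 0 := by
    intro j
    induction j with
    | zero =>
      intro _ v hv
      rw [countProb, if_neg]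
      rintro rfl
      exact hv hG.1
    | succ j ih =>
      intro hj w' hw'
      rw [countProb, dif_pos (show j < t by omega)]
      refine Finset.sum_eq_zero fun m _ => Finset.sum_eq_zero fun v _ => ?_
      by_cases hv : v ∈ G j
      · rw [if_neg]
        rintro rfl
        obtain ⟨w, hw, hc, -⟩ := henc ⟨j, hj⟩ m v hv
        have : E ⟨j, hj⟩ m (observe Info.IA v) = parity w := hc
        rw [this, newCount_parity (mem_successors.1 hw).2] at hw'
        exact hw' (mem_successors.1 hw).1
      · rw [ih (by omega) v hv, mul_zero, ite_self]
  refine ⟨M, ⟨E, fun j s _ => f j s, fun _ j m v hv k => ?_⟩, fun j => ?_, hMD⟩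
  · obtain ⟨w, hw, hc, -⟩ := henc j m v (hreach j j.2.le v hv)
    have : E j m (observe Info.IA v) = parity w := hc
    rw [this, Fin.val_add, parity_val, parity_val]
    have h1 := (mem_successors.1 hw).2 k
    have h2 := (w k).isLt
    have h3 := (v k).isLt
    rcases h1 with h1 | h1 <;> omega
  · unfold Code.errorProb
    refine Finset.sum_eq_zero fun m _ => Finset.sum_eq_zero fun v _ => ?_
    by_cases hv : v ∈ G j
    · obtain ⟨w, hw, hc, hfw⟩ := henc j m v hv
      have : E j m (observe Info.IA v) = parity w := hc
      simp only [this]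
      rw [newState_eq_parity, newCount_parity (mem_successors.1 hw).2, if_pos hfw, mul_zero]
    · simp only
      rw [hprob j j.2.le v hv, mul_zero, zero_mul]

/-! ### Comparison of the models -/

/-- A decoder with full information can do what a decoder with less information does. -/
def Code.informDecoder {X Y : Info} {M : Fin t → ℕ} (C : Code X Y n t ℓ M) :
    Code X Info.IA n t ℓ M where
  enc := C.enc
  dec j s v := C.dec j s (observe (n := n) (ℓ := ℓ) Y v)
  admissible := C.admissible

theorem Code.errorProb_informDecoder {X Y : Info} {M : Fin t → ℕ} (C : Code X Y n t ℓ M)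
    (j : Fin t) : C.informDecoder.errorProb j = C.errorProb j := rfl

/-- The code in which the decoder does not use its information. -/
def Code.ofUninformed {X Y : Info} {M : Fin t → ℕ} (C : Code X Info.U n t ℓ M) :
    Code X Y n t ℓ M where
  enc := C.enc
  dec j s _ := C.dec j s ()
  admissible := C.admissible

theorem Code.errorProb_ofUninformed {X Y : Info} {M : Fin t → ℕ} (C : Code X Info.U n t ℓ M)
    (j : Fin t) : (C.ofUninformed (Y := Y)).errorProb j = C.errorProb j := rfl

theorem allowedError_le (g : ErrorMode) {ε : ℝ} (hε : 0 ≤ ε) : allowedError g ε ≤ ε := by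
  cases g <;> simp [allowedError, hε]

theorem allowedError_nonneg (g : ErrorMode) {ε : ℝ} (hε : 0 ≤ ε) : 0 ≤ allowedError g ε := by
  cases g <;> simp [allowedError, hε]

theorem allowedError_mono (g : ErrorMode) {ε δ : ℝ} (h : ε ≤ δ) :
    allowedError g ε ≤ allowedError g δ := by
  cases g <;> simp [allowedError, h]

theorem Achievable.ofUninformed {X Y : Info} {g : ErrorMode} {R : Fin t → ℝ}
    (h : Achievable X Info.U ErrorMode.zero t ℓ R) : Achievable X Y g t ℓ R := by
  intro ε hε
  obtain ⟨n, M, C, hn, hC⟩ := h ε hε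
  exact ⟨n, M, C.ofUninformed, hn, fun j =>
    ⟨(C.errorProb_ofUninformed j).trans_le ((hC j).1.trans (allowedError_nonneg g hε.le)),
      (hC j).2⟩⟩

theorem exists_pos_mul_lt_pow {η : ℝ} (hη : 0 < η) (t : ℕ) {δ : ℝ} (hδ : 0 < δ) :
    ∃ ε, 0 < ε ∧ ε ≤ δ ∧ t * ε < η ^ t := by
  have hp : 0 < η ^ t := by positivity
  refine ⟨min δ (η ^ t / (t + 1)), by positivity, min_le_left _ _, ?_⟩
  calc (t : ℝ) * min δ (η ^ t / (t + 1)) ≤ t * (η ^ t / (t + 1)) :=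
        mul_le_mul_of_nonneg_left (min_le_right _ _) (by positivity)
    _ < η ^ t := by
      rw [mul_div_assoc', div_lt_iff₀ (by positivity)]
      nlinarith

theorem exists_logb_one_sub (δ : ℝ) (hδ : 0 < δ) :
    ∃ η : ℝ, 0 < η ∧ η ≤ 1 / 4 ∧ -δ ≤ Real.logb 2 (1 - 2 * η) := by
  have hc : ContinuousAt (fun η : ℝ => Real.logb 2 (1 - 2 * η)) 0 := by
    unfold Real.logb
    refine ContinuousAt.div_const (ContinuousAt.log (by fun_prop) (by norm_num)) _
  have h0 : (fun η : ℝ => Real.logb 2 (1 - 2 * η)) 0 = 0 := by simp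
  have hev := hc.eventually (lt_mem_nhds (show -δ < (fun η : ℝ => Real.logb 2 (1 - 2 * η)) 0 by
    rw [h0]; linarith))
  obtain ⟨r, hr, hball⟩ := Metric.eventually_nhds_iff.1 hev
  refine ⟨min (r / 2) (1 / 4), by positivity, min_le_right _ _, (hball ?_).le⟩
  rw [dist_zero_right, Real.norm_of_nonneg (by positivity)]
  have := min_le_left (r / 2) (1 / 4)
  linarith

theorem exists_logb_div_le (c δ : ℝ) (hc : 0 < c) (hδ : 0 < δ) :
    ∃ N : ℕ, 0 < N ∧ ∀ n ≥ N, Real.logb 2 (c * n) / n ≤ δ := by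
  have h1 : Tendsto (fun n : ℕ => Real.logb 2 (c * n) / n) atTop (𝓝 0) := by
    have h2 : Tendsto (fun x : ℝ => Real.log x / x) atTop (𝓝 0) :=
      Real.isLittleO_log_id_atTop.tendsto_div_nhds_zero
    have h3 : Tendsto (fun n : ℕ => c * (n : ℝ)) atTop atTop :=
      tendsto_natCast_atTop_atTop.const_mul_atTop hc
    have h4 := (h2.comp h3).mul_const (c / Real.log 2)
    rw [zero_mul] at h4
    refine h4.congr fun n => ?_
    simp only [Function.comp, Real.logb]
    field_simp
  obtain ⟨N, hN⟩ := eventually_atTop.1 (h1.eventually (gt_mem_nhds hδ))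
  exact ⟨N + 1, by omega, fun n hn => (hN n (by omega)).le⟩

/-- Every rate tuple that is achievable with small errors and an informed decoder is achievable
with zero error, an informed encoder and an uninformed decoder. -/
theorem Achievable.zero_uninformed {X : Info} {R : Fin t → ℝ}
    (h : Achievable X Info.IA ErrorMode.eps t ℓ R) :
    Achievable Info.IA Info.U ErrorMode.zero t ℓ R := by
  intro δ hδ
  obtain ⟨η, hη, hη4, hlog⟩ := exists_logb_one_sub (δ / 3) (by positivity)
  obtain ⟨ε, hε, hεδ, hεη⟩ := exists_pos_mul_lt_pow (η := 2 * η) (by positivity) t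
    (show 0 < δ / 3 by positivity)
  obtain ⟨n, M, C, hn, hC⟩ := h ε hε
  obtain ⟨G, hG⟩ := C.exists_isTree (η := 2 * η) (by positivity) (by linarith) hεη
    fun j => (hC j).1
  obtain ⟨N, hN, hNlog⟩ := exists_logb_div_le (4 * (ℓ + 1)) (δ / 3) (by positivity)
    (by positivity)
  have hη1 : 0 < 1 - 2 * η := by linarith
  have hMpos : ∀ j, (0 : ℝ) < M j := fun j => by exact_mod_cast C.pos j
  have hD : ∀ j, 0 < (1 - 2 * η) * M j := fun j => mul_pos hη1 (hMpos j)
  -- The length `n` given by achievability may be small; passing to `N * n` cells keeps the rates of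
  -- the tree and makes the colouring loss negligible.
  obtain ⟨G', hG'⟩ := hG.exists_pow (fun j => (hD j).le) N
  obtain ⟨M', C', hC', hM'⟩ := hG'.exists_code (fun j => pow_pos (hD j) N) (Nat.mul_pos hN hn)
  refine ⟨N * n, M', C', Nat.mul_pos hN hn, fun j => ⟨(hC' j).le, ?_⟩⟩
  have hn' : (0 : ℝ) < n := by exact_mod_cast hn
  have hn1 : (1 : ℝ) ≤ n := by exact_mod_cast hn
  have hN' : (0 : ℝ) < N := by exact_mod_cast hN
  have hNn : (0 : ℝ) < ((N * n : ℕ) : ℝ) := by exact_mod_cast Nat.mul_pos hN hn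
  have h1 := Real.logb_le_logb_of_le one_lt_two
    (div_pos (pow_pos (hD j) N) (by positivity)) (hM' j)
  rw [Real.logb_div (pow_pos (hD j) N).ne' (by positivity), Real.logb_pow,
    Real.logb_mul hη1.ne' (hMpos j).ne'] at h1
  have h2 := hNlog (N * n) (Nat.le_mul_of_pos_right N hn)
  have h3 := (hC j).2
  have h4 := div_le_div_of_nonneg_right h1 hNn.le
  rw [sub_div] at h4
  have h5 : (N : ℝ) * (Real.logb 2 (1 - 2 * η) + Real.logb 2 (M j)) / ((N * n : ℕ) : ℝ)
      = Real.logb 2 (1 - 2 * η) / n + Real.logb 2 (M j) / n := by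
    push_cast
    field_simp
  have h6 : -(δ / 3) ≤ Real.logb 2 (1 - 2 * η) / n := by
    rw [le_div_iff₀ hn']
    nlinarith
  linarith

theorem capacityRegion_subset {X : Info} (Y : Info) (g : ErrorMode) :
    capacityRegion X Info.IA ErrorMode.eps t ℓ ⊆ capacityRegion Info.IA Y g t ℓ :=
  fun _ hR => ⟨hR.1, hR.2.zero_uninformed.ofUninformed⟩

/-! ### Compactness of the capacity regions -/

theorem isClosed_capacityRegion (X Y : Info) (g : ErrorMode) :
    IsClosed (capacityRegion X Y g t ℓ) := by
  refine IsSeqClosed.isClosed fun u R hu hlim => ⟨fun j => ?_, fun ε hε => ?_⟩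
  · exact ge_of_tendsto' ((tendsto_pi_nhds.1 hlim) j) fun i => (hu i).1 j
  · have h1 : ∀ j, ∀ᶠ i in atTop, R j - ε / 2 < u i j := fun j =>
      ((tendsto_pi_nhds.1 hlim) j).eventually (lt_mem_nhds (by linarith))
    obtain ⟨i, hi⟩ := (eventually_all.2 h1).exists
    obtain ⟨n, M, C, hn, hC⟩ := (hu i).2 (ε / 2) (by positivity)
    refine ⟨n, M, C, hn, fun j => ⟨(hC j).1.trans (allowedError_mono g (by linarith)), ?_⟩⟩
    have := hi j
    have := (hC j).2
    linarith

/-- Even with a fully informed decoder, at a good count vector half of the messages lead to distinct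
successors, and there are at most `2 ^ n` of these. This crude bound serves only for boundedness of
the region. -/
theorem Code.card_le {X Y : Info} {M : Fin t → ℕ} (C : Code X Y n t ℓ M) {ε : ℝ}
    (hε : t * ε < (1 / 2) ^ t) (herr : ∀ j, C.errorProb j ≤ ε) (j : Fin t) :
    (M j : ℝ) ≤ 2 * 2 ^ n := by
  classical
  obtain ⟨G, h0, hG⟩ := C.informDecoder.exists_isTree (η := 1 / 2) (by norm_num) (by norm_num) hε
    herr
  have hcard : ∀ (S : Set (CountVec n ℓ)) v, ((successors S v).card : ℝ) ≤ 2 ^ n := fun S v => by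
    exact_mod_cast card_successors_le S v
  have hne : ∀ i ≤ t, (G i).Nonempty := by
    intro i
    induction i with
    | zero => exact fun _ => ⟨_, h0⟩
    | succ i ih =>
      intro hi
      obtain ⟨v, hv⟩ := ih (by omega)
      have h1 := hG ⟨i, hi⟩ v hv
      have hM : (0 : ℝ) < M ⟨i, hi⟩ := by exact_mod_cast C.pos ⟨i, hi⟩
      have h2 : (0 : ℝ) < (successors (G (i + 1)) v).card := by
        refine lt_of_lt_of_le ?_ h1
        linarith
      obtain ⟨w, hw⟩ := Finset.card_pos.1 (by exact_mod_cast h2)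
      exact ⟨w, (mem_successors.1 hw).1⟩
  obtain ⟨v, hv⟩ := hne j j.2.le
  have h1 := hG j v hv
  have h2 := hcard (G (j + 1)) v
  linarith

theorem capacityRegion_subset_Icc (X Y : Info) (g : ErrorMode) :
    capacityRegion X Y g t ℓ ⊆ Set.Icc 0 (fun _ => 3) := by
  intro R hR
  refine ⟨hR.1, fun j => ?_⟩
  obtain ⟨ε, hε, hε1, hεt⟩ := exists_pos_mul_lt_pow (η := 1 / 2) (by norm_num) t one_pos
  obtain ⟨n, M, C, hn, hC⟩ := hR.2 ε hε
  have h1 := C.card_le hεt (fun j => (hC j).1.trans (allowedError_le g hε.le)) j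
  have h2 := Real.logb_le_logb_of_le one_lt_two (by exact_mod_cast C.pos j) h1
  rw [Real.logb_mul (by norm_num) (by positivity), Real.logb_pow, Real.logb_self_eq_one one_lt_two]
    at h2
  have hn' : (1 : ℝ) ≤ n := by exact_mod_cast hn
  have h3 : Real.logb 2 (M j) / n ≤ 2 := by
    rw [div_le_iff₀ (by linarith)]
    linarith
  have := (hC j).2
  simp only
  linarith

/-- The encoders that leave all cells unchanged, if they know the states. -/
def idleEncoders (n t ℓ : ℕ) : (X : Info) → Encoders X n t ℓ fun _ => 1
  | Info.IA => fun _ _ v => parity (n := n) (ℓ := ℓ) v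
  | Info.IP => fun _ _ s => s
  | Info.U => fun _ _ _ _ => 0

theorem zero_mem_capacityRegion (X Y : Info) (g : ErrorMode) :
    (0 : Fin t → ℝ) ∈ capacityRegion X Y g t ℓ := by
  refine ⟨fun _ => le_rfl, fun ε hε =>
    ⟨1, fun _ => 1, ⟨idleEncoders 1 t ℓ X, fun _ _ _ => 0, ?_⟩, one_pos, fun j => ⟨?_, ?_⟩⟩⟩
  · rintro rfl j m v - k
    have h := (v k).isLt
    have : ((parity v k + parity v k : Fin 2) : ℕ) = 0 := by
      rw [Fin.val_add]
      omega
    change (v k : ℕ) + ((parity v k + parity v k : Fin 2) : ℕ) ≤ ℓ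
    omega
  · refine le_of_eq_of_le ?_ (allowedError_nonneg g hε.le)
    unfold Code.errorProb
    refine Finset.sum_eq_zero fun m _ => Finset.sum_eq_zero fun v _ => ?_
    rw [if_pos (Subsingleton.elim (α := Fin 1) _ _), mul_zero]
  · simp [hε.le]

theorem isGreatest_maxSumRate (X Y : Info) (g : ErrorMode) :
    IsGreatest (sumRates X Y g t ℓ) (maxSumRate X Y g t ℓ) := by
  have hc : IsCompact (sumRates X Y g t ℓ) :=
    (isCompact_Icc.of_isClosed_subset (isClosed_capacityRegion X Y g)
      (capacityRegion_subset_Icc X Y g)).image (by fun_prop)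
  exact hc.isGreatest_sSup ⟨_, Set.mem_image_of_mem _ (zero_mem_capacityRegion X Y g)⟩

/-! ### Lower bound for informed encoders: trees from histories -/

theorem ways_pos (r : ℕ) (i : Fin (ℓ + 1)) : 0 < ways r i := by
  induction r generalizing i with
  | zero => exact one_pos
  | succ r ih =>
    unfold ways
    refine Finset.sum_pos' (fun _ _ => Nat.zero_le _) ⟨i, Finset.mem_univ _, ?_⟩
    rw [if_pos (show CellStep i i from Or.inl rfl)]
    exact ih i

theorem prod_ways_succ (r : ℕ) (v : CountVec n ℓ) :
    ∏ k, ways (r + 1) (v k) = ∑ w ∈ successors Set.univ v, ∏ k, ways r (w k) := by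
  classical
  have := sum_prod_ite (fun k (a : Fin (ℓ + 1)) => CellStep (v k) a) (fun _ a => ways r a)
  simp only [ways]
  rw [← this, successors, Finset.sum_filter]
  refine Finset.sum_congr rfl fun w _ => ?_
  by_cases h : ∀ k, CellStep (v k) (w k)
  · rw [if_pos h, if_pos ⟨Set.mem_univ _, h⟩]
  · rw [if_neg h, if_neg fun h' => h h'.2]

/-- From `v` there is a tree of `r` writes in which every vector has at least `2 ^ e j` successors
at the `j`-th write. -/
def HasTree : ℕ → (ℕ → ℕ) → CountVec n ℓ → Prop
  | 0, _, _ => True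
  | r + 1, e, v => 2 ^ e 0 ≤ (successors {w | HasTree r (fun j => e (j + 1)) w} v).card

/-- Extension by zero. -/
def extendZero {r s : ℕ} (p : Fin r → Fin s) (j : ℕ) : ℕ := if h : j < r then p ⟨j, h⟩ else 0

theorem extendZero_cons_succ {r s : ℕ} (a : Fin s) (p : Fin r → Fin s) (j : ℕ) :
    extendZero (Fin.cons a p : Fin (r + 1) → Fin s) (j + 1) = extendZero p j := by
  unfold extendZero
  by_cases h : j < r
  · rw [dif_pos h, dif_pos (by omega)]
    have : (⟨j + 1, by omega⟩ : Fin (r + 1)) = Fin.succ ⟨j, h⟩ := rfl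
    rw [this, Fin.cons_succ]
  · rw [dif_neg h, dif_neg (by omega)]

theorem extendZero_cons_zero {r s : ℕ} (a : Fin s) (p : Fin r → Fin s) :
    extendZero (Fin.cons a p : Fin (r + 1) → Fin s) 0 = a := by
  simp [extendZero]

/-- The degrees must be uniform because message sets do not depend on `v`. By induction each
successor has its own profile of exponents; keeping the profile of largest total weight costs `(n +
1) ^ r`, and rounding the first degree down to a power of 2 costs a factor 2. Exponents are at most
`n` since a vector has at most `2 ^ n` successors. -/
theorem exists_hasTree {r : ℕ} (hr : r ≤ t) (v : CountVec n ℓ) :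
    ∃ p : Fin r → Fin (n + 1), HasTree r (extendZero p) v ∧
      ∏ k, ways r (v k) ≤ (2 * (n + 1) ^ t) ^ r * 2 ^ ∑ j ∈ Finset.range r, extendZero p j := by
  classical
  induction r generalizing v with
  | zero => exact ⟨Fin.elim0, trivial, by simp [ways]⟩
  | succ r ih =>
    choose p hp hle using ih (by omega)
    let F : (Fin r → Fin (n + 1)) → ℕ := fun q =>
      ∑ w ∈ (successors Set.univ v).filter (fun w => p w = q), ∏ k, ways r (w k)
    obtain ⟨q, -, hq⟩ := Finset.exists_max_image Finset.univ F Finset.univ_nonempty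
    have h1 : ∏ k, ways (r + 1) (v k) ≤ (n + 1) ^ r * F q := by
      rw [prod_ways_succ, ← Finset.sum_fiberwise (successors Set.univ v) p]
      refine (Finset.sum_le_card_nsmul _ _ (F q) fun q' _ => hq q' (Finset.mem_univ _)).trans ?_
      simp
    set cls := (successors Set.univ v).filter (fun w => p w = q) with hcls
    have h2 : F q ≤ cls.card *
        ((2 * (n + 1) ^ t) ^ r * 2 ^ ∑ j ∈ Finset.range r, extendZero q j) := by
      refine Finset.sum_le_card_nsmul _ _ _ fun w hw => ?_
      rw [← (Finset.mem_filter.1 hw).2]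
      exact hle w
    have hne : cls.card ≠ 0 := by
      intro h0
      rw [h0, zero_mul] at h2
      have := Finset.prod_pos fun k (_ : k ∈ Finset.univ) => ways_pos (r + 1) (v k)
      rw [Nat.le_zero.1 h2, mul_zero] at h1
      omega
    have hsub : cls ⊆ successors {w | HasTree r (extendZero q) w} v := by
      intro w hw
      obtain ⟨h, h'⟩ := Finset.mem_filter.1 hw
      exact mem_successors.2 ⟨h' ▸ hp w, (mem_successors.1 h).2⟩
    have hlog : Nat.log 2 cls.card < n + 1 := by
      have := Nat.log_mono_right (b := 2)
        ((Finset.card_le_card hsub).trans (card_successors_le _ _))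
      rw [Nat.log_pow one_lt_two] at this
      omega
    refine ⟨Fin.cons ⟨Nat.log 2 cls.card, hlog⟩ q, ?_, ?_⟩
    · unfold HasTree
      simp only [extendZero_cons_zero, extendZero_cons_succ]
      exact (Nat.pow_log_le_self 2 hne).trans (Finset.card_le_card hsub)
    · rw [Finset.sum_range_succ', extendZero_cons_zero]
      simp only [extendZero_cons_succ]
      have h3 : cls.card ≤ 2 * 2 ^ Nat.log 2 cls.card := by
        have := Nat.lt_pow_succ_log_self one_lt_two cls.card
        rw [pow_succ] at this
        omega
      calc _ ≤ (n + 1) ^ r * F q := h1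
        _ ≤ (n + 1) ^ t * (2 * 2 ^ Nat.log 2 cls.card *
            ((2 * (n + 1) ^ t) ^ r * 2 ^ ∑ j ∈ Finset.range r, extendZero q j)) :=
          Nat.mul_le_mul (Nat.pow_le_pow_right (by omega) (by omega))
            (h2.trans (Nat.mul_le_mul_right _ h3))
        _ = _ := by rw [pow_succ, pow_add]; ring

theorem exists_isTree (n t ℓ : ℕ) : ∃ (e : ℕ → ℕ) (G : ℕ → Set (CountVec n ℓ)),
    IsTree (fun j : Fin t => (2 : ℝ) ^ e j) G ∧
      ways t (0 : Fin (ℓ + 1)) ^ n ≤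
        (2 * (n + 1) ^ t) ^ t * 2 ^ ∑ j ∈ Finset.range t, e j := by
  obtain ⟨p, hp, hle⟩ := exists_hasTree (le_refl t) (fun _ : Fin n => (0 : Fin (ℓ + 1)))
  refine ⟨extendZero p, fun j => {w | HasTree (t - j) (fun i => extendZero p (i + j)) w},
    ⟨hp, fun j v hv => ?_⟩, by simpa using hle⟩
  have h1 : t - (j : ℕ) = t - (j + 1) + 1 := by have := j.2; omega
  simp only [Set.mem_ofPred_eq] at hv
  rw [h1] at hv
  unfold HasTree at hv
  simp only [zero_add, add_right_comm _ 1 (j : ℕ), add_assoc] at hv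
  have := (Nat.cast_le (α := ℝ)).2 hv
  rwa [Nat.cast_pow, Nat.cast_two] at this

theorem exists_sumRate_ge (t ℓ : ℕ) {δ : ℝ} (hδ : 0 < δ) :
    ∃ x ∈ sumRates Info.IA Info.U ErrorMode.zero t ℓ,
      Real.logb 2 (ways t (0 : Fin (ℓ + 1))) - δ ≤ x := by
  -- With `c` the logarithm of the colouring loss, the colourings cost `t * c` and the pigeonhole at
  -- most `t * (t + 1) * c`. The added 1 keeps the denominator positive for `t = 0`.
  obtain ⟨n, hn, hlog⟩ := exists_logb_div_le (4 * (ℓ + 1)) (δ / (t * (t + 2) + 1))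
    (by positivity) (by positivity)
  replace hlog := hlog n le_rfl
  obtain ⟨e, G, hG, hle⟩ := exists_isTree n t ℓ
  obtain ⟨M, C, hC, hM⟩ := hG.exists_code (fun j => by positivity) hn
  have hn' : (1 : ℝ) ≤ n := by exact_mod_cast hn
  have hM1 : ∀ j, (1 : ℝ) ≤ M j := fun j => by exact_mod_cast C.pos j
  refine ⟨_, ⟨fun j => Real.logb 2 (M j) / n, ⟨fun j => ?_, fun ε hε => ?_⟩, rfl⟩, ?_⟩
  · exact div_nonneg (Real.logb_nonneg one_lt_two (hM1 j)) (by positivity)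
  -- A zero-error code achieves its own rates exactly, so the same code serves every `ε`.
  · exact ⟨n, M, C, hn, fun j => ⟨(hC j).le, by linarith⟩⟩
  simp only
  set c := Real.logb 2 (4 * (ℓ + 1) * n) with hc
  have h1 : ∀ j : Fin t, (e j : ℝ) - c ≤ Real.logb 2 (M j) := by
    intro j
    have := Real.logb_le_logb_of_le one_lt_two (by positivity) (hM j)
    rwa [Real.logb_div (by positivity) (by positivity), Real.logb_pow,
      Real.logb_self_eq_one one_lt_two, mul_one] at this
  have hc4 : Real.logb 2 (2 * (n + 1) ^ t : ℝ) ≤ (t + 1) * c := by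
    have h : (2 * (n + 1) ^ t : ℝ) ≤ (4 * (ℓ + 1) * n) ^ (t + 1) := by
      rw [pow_succ, mul_comm]
      have hl : (0 : ℝ) ≤ ℓ * n := by positivity
      refine mul_le_mul (pow_le_pow_left₀ (by positivity) ?_ _) ?_ (by positivity) (by positivity)
      · nlinarith
      · nlinarith
    have := Real.logb_le_logb_of_le one_lt_two (by positivity) h
    rwa [Real.logb_pow, Nat.cast_add, Nat.cast_one] at this
  have h2 : n * Real.logb 2 (ways t (0 : Fin (ℓ + 1))) ≤
      t * Real.logb 2 (2 * (n + 1) ^ t : ℝ) + ∑ j : Fin t, (e j : ℝ) := by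
    have hw : (0 : ℝ) < ways t (0 : Fin (ℓ + 1)) := by exact_mod_cast ways_pos t 0
    have h : (ways t (0 : Fin (ℓ + 1)) : ℝ) ^ n ≤
        (2 * (n + 1) ^ t : ℝ) ^ t * 2 ^ ∑ j ∈ Finset.range t, e j := by exact_mod_cast hle
    have := Real.logb_le_logb_of_le one_lt_two (by positivity) h
    rw [Real.logb_mul (by positivity) (by positivity), Real.logb_pow, Real.logb_pow, Real.logb_pow,
      Real.logb_self_eq_one one_lt_two, mul_one, Nat.cast_sum] at this
    rwa [← Finset.sum_range fun j => (e j : ℝ)]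
  have h3 : ∑ j : Fin t, (e j : ℝ) - t * c ≤ ∑ j, Real.logb 2 (M j) := by
    have := Finset.sum_le_sum fun j (_ : j ∈ Finset.univ) => h1 j
    rwa [Finset.sum_sub_distrib, Finset.sum_const, Finset.card_univ, Fintype.card_fin,
      nsmul_eq_mul] at this
  have hcδ : (t * (t + 2) + 1) * c ≤ δ * n := by
    rw [div_le_div_iff₀ (by positivity) (by positivity)] at hlog
    linarith
  have hc0 : 0 ≤ c := Real.logb_nonneg one_lt_two (by
    have hl : (0 : ℝ) ≤ ℓ * n := by positivity
    nlinarith)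
  rw [← Finset.sum_div, le_div_iff₀ (by positivity)]
  have h4 : (t : ℝ) * Real.logb 2 (2 * (n + 1) ^ t : ℝ) ≤ t * ((t + 1) * c) :=
    mul_le_mul_of_nonneg_left hc4 (by positivity)
  nlinarith

/-! ### Two writes by a partially informed encoder -/

theorem Code.card_good_le {X : Info} {M : Fin t → ℕ} (C : Code X Info.IA n t ℓ M) (j : Fin t)
    (v : CountVec n ℓ) (B : Finset (Fin (M j))) (hB : ∀ m ∈ B, C.Correct j m v) :
    B.card ≤ (successors Set.univ v).card :=
  Finset.card_le_card_of_injOn (fun m => C.next j m v)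
    (fun _ _ => mem_successors.2 ⟨Set.mem_univ _, step_newCount _ _⟩)
    ((C.next_injOn j v).mono fun m hm => hB m hm)

theorem card_successors_univ (v : CountVec n ℓ) :
    (successors Set.univ v).card = ∏ k, ways 1 (v k) := by
  rw [prod_ways_succ]
  simp [ways]

/-- The count of a cell after it is programmed, if possible. -/
def up (i : Fin (ℓ + 1)) : Fin (ℓ + 1) := ⟨min ℓ ((i : ℕ) + 1), Nat.lt_succ_of_le (min_le_left _ _)⟩

/-- The state of a cell with count `i`. -/
def cellParity (i : Fin (ℓ + 1)) : Fin 2 := ⟨(i : ℕ) % 2, Nat.mod_lt _ Nat.two_pos⟩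

/-- The count of a cell after the state `x` is programmed. -/
def cellNext (i : Fin (ℓ + 1)) (x : Fin 2) : Fin (ℓ + 1) := if x = cellParity i then i else up i

theorem sum_cellStep (i : Fin (ℓ + 1)) (f : Fin (ℓ + 1) → ℕ) :
    ∑ i', (if CellStep i i' then f i' else 0) = f i + if (i : ℕ) < ℓ then f (up i) else 0 := by
  rw [← Finset.sum_filter]
  split_ifs with h
  · have hne : i ≠ up i := by
      intro e
      have := congrArg Fin.val e
      simp only [up] at this
      omega
    rw [← Finset.sum_pair hne]
    refine Finset.sum_congr ?_ fun _ _ => rfl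
    ext i'
    rw [Finset.mem_filter]
    simp only [Finset.mem_univ, true_and, CellStep, Finset.mem_insert, Finset.mem_singleton,
      Fin.ext_iff, up]
    omega
  · rw [add_zero, ← Finset.sum_singleton f i]
    refine Finset.sum_congr ?_ fun _ _ => rfl
    ext i'
    have := i'.2
    rw [Finset.mem_filter]
    simp only [Finset.mem_univ, true_and, CellStep, Finset.mem_singleton, Fin.ext_iff]
    omega

theorem sum_cellNext {i i' : Fin (ℓ + 1)} (h : cellParity i = cellParity i')
    (F : Fin (ℓ + 1) → Fin (ℓ + 1) → ℝ) :
    ∑ x : Fin 2, (if (i : ℕ) < ℓ ∨ x = cellParity i then F (cellNext i x) (cellNext i' x) else 0)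
      = F i i' + if (i : ℕ) < ℓ then F (up i) (up i') else 0 := by
  unfold cellNext
  rw [← h]
  generalize cellParity i = p
  fin_cases p
  · simp [Fin.sum_univ_two]
  · simp [Fin.sum_univ_two, add_comm]

theorem ways_succ (r : ℕ) (i : Fin (ℓ + 1)) :
    ways (r + 1) i = ways r i + if (i : ℕ) < ℓ then ways r (up i) else 0 :=
  sum_cellStep i (ways r)

theorem ways_one (i : Fin (ℓ + 1)) : ways 1 i = if (i : ℕ) < ℓ then 2 else 1 := by
  rw [ways_succ]
  simp only [ways]
  split_ifs <;> rfl

/-- For two cells with the same state that are programmed together: the sum over the next write of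
the geometric mean of the numbers of possibilities at the write after it. -/
noncomputable def pairWays (i i' : Fin (ℓ + 1)) : ℝ :=
  √((ways 1 i : ℝ) * ways 1 i') +
    if (i : ℕ) < ℓ then √((ways 1 (up i) : ℝ) * ways 1 (up i')) else 0

theorem pairWays_self (i : Fin (ℓ + 1)) : pairWays i i = ways 2 i := by
  rw [ways_succ, pairWays, Real.sqrt_mul_self (Nat.cast_nonneg _),
    Real.sqrt_mul_self (Nat.cast_nonneg _)]
  push_cast
  rfl

/-- Cells with these counts have the same state, and both or neither of them can be programmed. -/
def Similar (i i' : Fin (ℓ + 1)) : Prop :=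
  cellParity i = cellParity i' ∧ ((i : ℕ) < ℓ ↔ (i' : ℕ) < ℓ)

theorem newState_eq_of_similar {v v' : CountVec n ℓ} (h : ∀ k, Similar (v k) (v' k))
    (c : StateVec n) : newState v c = newState v' c := by
  funext k
  have hp : parity v k = parity v' k := (h k).1
  simp only [newState, (h k).2, hp]

theorem newCount_newState (v : CountVec n ℓ) (c : StateVec n) :
    newCount v (newState v c) = newCount v c := by
  rw [newState_eq_parity, newCount_parity (step_newCount v c)]

/-- The encoder sees the same states at `v` and `v'`, hence programs the same vector and produces
the same new states. For each message in `B` both resulting count vectors have at least `q`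
successors, so the geometric mean of these numbers is at least `q`. Distinct messages in `B` give
distinct new states; summing over all possible ones factorizes over the cells. -/
theorem Code.mul_le_prod_pairWays {M : Fin t → ℕ} (C : Code Info.IP Info.IA n t ℓ M) (j : Fin t)
    {v v' : CountVec n ℓ} (h : ∀ k, Similar (v k) (v' k)) (B : Finset (Fin (M j))) (q : ℝ)
    (hB : ∀ m ∈ B, C.Correct j m v)
    (hq : ∀ m ∈ B, q ≤ (successors Set.univ (C.next j m v)).card)
    (hq' : ∀ m ∈ B, q ≤ (successors Set.univ (C.next j m v')).card) :
    B.card * q ≤ ∏ k, pairWays (v k) (v' k) := by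
  classical
  have hobs : parity v = parity v' := funext fun k => (h k).1
  let c : Fin (M j) → StateVec n := fun m => C.enc j m (parity v)
  let F : Fin (ℓ + 1) → Fin (ℓ + 1) → ℝ := fun i i' => √((ways 1 i : ℝ) * ways 1 i')
  let Φ : StateVec n → ℝ := fun x => ∏ k, F (cellNext (v k) (x k)) (cellNext (v' k) (x k))
  have hΦ : ∀ m ∈ B, q ≤ Φ (newState v (c m)) := by
    intro m hm
    have h1 := hq m hm
    have h2 := hq' m hm
    have e1 : C.next j m v = newCount v (newState v (c m)) := (newCount_newState _ _).symm
    have e2 : C.next j m v' = newCount v' (newState v (c m)) := by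
      rw [newState_eq_of_similar h, newCount_newState]
      change newCount v' (C.enc j m (parity v')) = newCount v' (C.enc j m (parity v))
      rw [hobs]
    rw [e1, card_successors_univ, Nat.cast_prod] at h1
    rw [e2, card_successors_univ, Nat.cast_prod] at h2
    have h3 : Φ (newState v (c m)) = √((∏ k, (ways 1 (newCount v (newState v (c m)) k) : ℝ)) *
        ∏ k, (ways 1 (newCount v' (newState v (c m)) k) : ℝ)) := by
      rw [← Finset.prod_mul_distrib]
      symm
      rw [Real.sqrt_eq_iff_mul_self_eq_of_pos]
      · simp only [Φ, F]
        rw [← Finset.prod_mul_distrib]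
        exact Finset.prod_congr rfl fun k _ => Real.mul_self_sqrt (by positivity)
      · refine Finset.prod_pos fun k _ => Real.sqrt_pos.2 ?_
        exact mul_pos (by exact_mod_cast ways_pos _ _) (by exact_mod_cast ways_pos _ _)
    rw [h3]
    rcases le_or_gt q 0 with hq0 | hq0
    · exact hq0.trans (Real.sqrt_nonneg _)
    · refine Real.le_sqrt_of_sq_le ?_
      rw [sq]
      exact mul_le_mul h1 h2 hq0.le (hq0.le.trans h1)
  have hinj : Set.InjOn (fun m => newState v (c m)) B := by
    intro m hm m' hm' e
    rw [← hB m hm, ← hB m' hm']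
    exact congrArg (fun s => C.dec j s v) e
  calc B.card * q = ∑ m ∈ B, q := by simp
    _ ≤ ∑ m ∈ B, Φ (newState v (c m)) := Finset.sum_le_sum hΦ
    _ = ∑ x ∈ B.image fun m => newState v (c m), Φ x := by
      rw [Finset.sum_image hinj]
    _ ≤ ∑ x ∈ Finset.univ.filter (fun x : StateVec n =>
          ∀ k, (v k : ℕ) < ℓ ∨ x k = cellParity (v k)), Φ x := by
      refine Finset.sum_le_sum_of_subset_of_nonneg ?_ fun x _ _ =>
        Finset.prod_nonneg fun k _ => Real.sqrt_nonneg _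
      intro x hx
      obtain ⟨m, -, rfl⟩ := Finset.mem_image.1 hx
      refine Finset.mem_filter.2 ⟨Finset.mem_univ _, fun k => ?_⟩
      by_cases hk : (v k : ℕ) < ℓ
      · exact Or.inl hk
      · right
        simp only [newState, hk, if_false]
        rfl
    _ = ∏ k, ∑ x : Fin 2, (if (v k : ℕ) < ℓ ∨ x = cellParity (v k) then
          F (cellNext (v k) x) (cellNext (v' k) x) else 0) := by
      rw [Finset.sum_filter, ← sum_prod_ite]
    _ = ∏ k, pairWays (v k) (v' k) :=
      Finset.prod_congr rfl fun k _ => sum_cellNext (h k).1 F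

/-! ### Weights of the first writes -/

/-- `A v` counts the sequences of good messages that lead to `v`. Correct decoding makes distinct
sequences follow distinct count histories, so there are at most as many as histories ending in `v`.
-/
theorem Code.exists_prefix_weights {X : Info} {M : Fin t → ℕ} (C : Code X Info.IA n t ℓ M)
    {η : ℝ} (hη : η ≤ 1)
    {G : ℕ → Set (CountVec n ℓ)} (h0 : (fun _ => 0) ∈ G 0) (hG : ∀ j : Fin t, ∀ v ∈ G j,
      ∃ B : Finset (Fin (M j)), (∀ m ∈ B, C.Correct j m v ∧ C.next j m v ∈ G (j + 1)) ∧
        (1 - η) * M j ≤ B.card) (j : ℕ) (hj : j ≤ t) :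
    ∃ A : CountVec n ℓ → ℝ, (∀ v, 0 ≤ A v) ∧ (∀ v ∉ G j, A v = 0) ∧
      (∀ v, A v ≤ ∏ k, (arrivals j (v k) : ℝ)) ∧
      ∏ i : Fin j, ((1 - η) * M (Fin.castLE hj i)) ≤ ∑ v, A v := by
  classical
  induction j with
  | zero =>
    refine ⟨fun v => if v = fun _ => 0 then 1 else 0, fun v => ?_, fun v hv => ?_, fun v => ?_, ?_⟩
    · simp only; split_ifs <;> norm_num
    · simp only
      rw [if_neg]
      rintro rfl
      exact hv h0
    · simp only
      split_ifs with h
      · simp [h, arrivals]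
      · positivity
    · simp
  | succ j ih =>
    obtain ⟨A, hA0, hAG, hAle, hAsum⟩ := ih (by omega)
    set i : Fin t := ⟨j, hj⟩ with hi
    have hB : ∀ v, ∃ B : Finset (Fin (M i)), v ∈ G j →
        (∀ m ∈ B, C.Correct i m v ∧ C.next i m v ∈ G (j + 1)) ∧ (1 - η) * M i ≤ B.card := by
      intro v
      by_cases hv : v ∈ G j
      · obtain ⟨B, hB⟩ := hG i v hv
        exact ⟨B, fun _ => hB⟩
      · exact ⟨∅, fun h => (hv h).elim⟩
    choose B hB using hB
    refine ⟨fun w => ∑ v, A v * ((B v).filter fun m => C.next i m v = w).card, fun w => ?_,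
      fun w hw => ?_, fun w => ?_, ?_⟩
    · exact Finset.sum_nonneg fun v _ => mul_nonneg (hA0 v) (Nat.cast_nonneg _)
    · refine Finset.sum_eq_zero fun v _ => ?_
      by_cases hv : v ∈ G j
      · rw [Finset.filter_false_of_mem]
        · simp
        · rintro m hm rfl
          exact hw ((hB v hv).1 m hm).2
      · rw [hAG v hv, zero_mul]
    · have : ∏ k, (arrivals (j + 1) (w k) : ℝ) =
          ∑ v : CountVec n ℓ, if ∀ k, CellStep (v k) (w k)
            then ∏ k, (arrivals j (v k) : ℝ) else 0 := by
        rw [sum_prod_ite (fun k (a : Fin (ℓ + 1)) => CellStep a (w k))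
          (fun _ a => (arrivals j a : ℝ))]
        simp [arrivals]
      rw [this]
      refine Finset.sum_le_sum fun v _ => ?_
      by_cases hv : v ∈ G j
      · split_ifs with hs
        · have hcard : ((B v).filter fun m => C.next i m v = w).card ≤ 1 := by
            refine Finset.card_le_one.2 fun m hm m' hm' => ?_
            rw [Finset.mem_filter] at hm hm'
            exact C.next_injOn i v ((hB v hv).1 m hm.1).1 ((hB v hv).1 m' hm'.1).1
              (hm.2.trans hm'.2.symm)
          have hcard' : (((B v).filter fun m => C.next i m v = w).card : ℝ) ≤ 1 := by
            exact_mod_cast hcard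
          nlinarith [hAle v, hA0 v]
        · rw [Finset.filter_false_of_mem]
          · simp
          · rintro m hm rfl
            exact hs (step_newCount _ _)
      · rw [hAG v hv, zero_mul]
        split_ifs <;> positivity
    · rw [Fin.prod_univ_castSucc, Finset.sum_comm]
      have hlast : Fin.castLE hj (Fin.last j) = i := rfl
      have hcast : ∀ a : Fin j, Fin.castLE hj a.castSucc = Fin.castLE (by omega) a := fun _ => rfl
      simp only [hlast, hcast]
      have h1 : ∀ v, A v * ((1 - η) * M i) ≤
          ∑ w, A v * (((B v).filter fun m => C.next i m v = w).card : ℝ) := by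
        intro v
        by_cases hv : v ∈ G j
        · rw [← Finset.mul_sum, ← Nat.cast_sum,
            ← Finset.card_eq_sum_card_fiberwise fun _ _ => Finset.mem_univ _]
          exact mul_le_mul_of_nonneg_left (hB v hv).2 (hA0 v)
        · simp [hAG v hv]
      refine le_trans ?_ (Finset.sum_le_sum fun v _ => h1 v)
      rw [← Finset.sum_mul]
      exact mul_le_mul_of_nonneg_right hAsum
        (mul_nonneg (by linarith) (Nat.cast_nonneg _))

theorem arrivals_pos {j : ℕ} {i : Fin (ℓ + 1)} (h : (i : ℕ) ≤ j) : 0 < arrivals j i := by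
  induction j generalizing i with
  | zero =>
    have : i = 0 := Fin.ext (by simpa using h)
    simp [arrivals, this]
  | succ j ih =>
    have hi := i.2
    unfold arrivals
    refine Finset.sum_pos' (fun _ _ => Nat.zero_le _)
      ⟨⟨(i : ℕ) - 1, by omega⟩, Finset.mem_univ _, ?_⟩
    rw [if_pos]
    · exact ih (by simp only; omega)
    · unfold CellStep
      simp only
      omega

/-! ### The loss from merging the counts `ℓ - 3` and `ℓ - 1` -/

/-- The map that merges the counts `ℓ - 3` and `ℓ - 1`. -/
def merge (i : Fin (ℓ + 1)) : Fin (ℓ + 1) :=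
  if (i : ℕ) + 3 = ℓ then ⟨ℓ - 1, by omega⟩ else i

theorem merge_eq_merge {i i' : Fin (ℓ + 1)} (h : merge i = merge i') :
    i = i' ∨ ((i : ℕ) + 3 = ℓ ∧ (i' : ℕ) + 1 = ℓ) ∨ ((i' : ℕ) + 3 = ℓ ∧ (i : ℕ) + 1 = ℓ) := by
  unfold merge at h
  have h' := congrArg Fin.val h
  rw [Fin.ext_iff]
  split_ifs at h' <;> first | omega | (simp only at h'; omega)

theorem similar_of_merge_eq {i i' : Fin (ℓ + 1)} (h : merge i = merge i') : Similar i i' := by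
  unfold Similar cellParity
  rw [Fin.ext_iff]
  simp only
  rcases merge_eq_merge h with rfl | h | h
  · simp
  · omega
  · omega

/-- Both cells have 2 continuations if left alone; after programming, the cell with count `ℓ - 1` is
exhausted and has 1, the other still 2. So the left side is `(2 + √2) ^ 2`, about 11.66, and the
right side is 12. -/
theorem pairWays_sq_lt {i i' : Fin (ℓ + 1)} (hi : (i : ℕ) + 1 = ℓ) (hi' : (i' : ℕ) + 3 = ℓ) :
    pairWays i i' ^ 2 < ways 2 i * ways 2 i' ∧ pairWays i' i ^ 2 < ways 2 i' * ways 2 i := by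
  have h1 : ways 1 i = 2 := by rw [ways_one, if_pos (by omega)]
  have h2 : ways 1 i' = 2 := by rw [ways_one, if_pos (by omega)]
  have h3 : ways 1 (up i) = 1 := by
    rw [ways_one, if_neg]
    simp only [up]
    omega
  have h4 : ways 1 (up i') = 2 := by
    rw [ways_one, if_pos]
    simp only [up]
    omega
  have h5 : ways 2 i = 3 := by rw [ways_succ, h1, h3, if_pos (by omega)]
  have h6 : ways 2 i' = 4 := by rw [ways_succ, h2, h4, if_pos (by omega)]
  have hs : √(2 : ℝ) * √2 = 2 := Real.mul_self_sqrt (by norm_num)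
  have hlt : √(2 : ℝ) < 1.45 := by
    rw [Real.sqrt_lt' (by norm_num)]
    norm_num
  have hss : √((2 : ℝ) * 2) = 2 := Real.sqrt_mul_self (by norm_num)
  unfold pairWays
  rw [h1, h2, h3, h4, h5, h6, if_pos (by omega), if_pos (by omega)]
  push_cast
  rw [hss, one_mul, mul_one]
  constructor <;> nlinarith

theorem pairWays_sq_le {i i' : Fin (ℓ + 1)} (h : merge i = merge i') :
    pairWays i i' ^ 2 ≤ ways 2 i * ways 2 i' := by
  rcases merge_eq_merge h with rfl | h | h
  · rw [pairWays_self, sq]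
  · exact (pairWays_sq_lt h.2 h.1).2.le
  · exact (pairWays_sq_lt h.2 h.1).1.le

/-- The number of count histories of one cell, over `s + 2` writes, whose count after `s` writes is
in the class `c`. -/
noncomputable def classWays (s : ℕ) (c : Fin (ℓ + 1)) : ℝ :=
  ∑ i, if merge i = c then (arrivals s i : ℝ) * ways 2 i else 0

/-- The bound for the square of `classWays` that results from encoding equally in a class. -/
noncomputable def classPairWays (s : ℕ) (c : Fin (ℓ + 1)) : ℝ :=
  ∑ i, if merge i = c then ∑ i', (if merge i' = c then
    (arrivals s i : ℝ) * arrivals s i' * pairWays i i' ^ 2 else 0) else 0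

theorem classPairWays_nonneg (s : ℕ) (c : Fin (ℓ + 1)) : 0 ≤ classPairWays s c := by
  refine Finset.sum_nonneg fun i _ => ?_
  split_ifs
  · refine Finset.sum_nonneg fun i' _ => ?_
    split_ifs <;> positivity
  · exact le_rfl

theorem classWays_nonneg (s : ℕ) (c : Fin (ℓ + 1)) : 0 ≤ classWays s c := by
  refine Finset.sum_nonneg fun i _ => ?_
  split_ifs <;> positivity

theorem sum_classWays (s : ℕ) :
    ∑ c : Fin (ℓ + 1), classWays s c = ways (s + 2) (0 : Fin (ℓ + 1)) := by
  rw [← sum_arrivals_mul_ways]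
  unfold classWays
  rw [Finset.sum_comm]
  simp

theorem classWays_sq (s : ℕ) (c : Fin (ℓ + 1)) : classWays s c ^ 2 =
    ∑ i, if merge i = c then ∑ i', (if merge i' = c then
      (arrivals s i : ℝ) * arrivals s i' * (ways 2 i * ways 2 i') else 0) else 0 := by
  unfold classWays
  rw [sq, Finset.sum_mul_sum]
  refine Finset.sum_congr rfl fun i _ => ?_
  split_ifs
  · refine Finset.sum_congr rfl fun i' _ => ?_
    split_ifs
    · ring
    · rw [mul_zero]
  · simp

theorem classPairWays_le_term (s : ℕ) (c i i' : Fin (ℓ + 1)) (hi : merge i = c) :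
    (if merge i' = c then (arrivals s i : ℝ) * arrivals s i' * pairWays i i' ^ 2 else 0) ≤
      if merge i' = c then (arrivals s i : ℝ) * arrivals s i' * (ways 2 i * ways 2 i') else 0 := by
  split_ifs with hi'
  · exact mul_le_mul_of_nonneg_left (pairWays_sq_le (hi.trans hi'.symm)) (by positivity)
  · exact le_rfl

theorem classPairWays_le (s : ℕ) (c : Fin (ℓ + 1)) : classPairWays s c ≤ classWays s c ^ 2 := by
  rw [classWays_sq]
  refine Finset.sum_le_sum fun i _ => ?_
  split_ifs with hi
  · exact Finset.sum_le_sum fun i' _ => classPairWays_le_term s c i i' hi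
  · exact le_rfl

/-- The merged class contains the cross term of `ℓ - 1` and `ℓ - 3`, which is strictly smaller. Its
weight is positive because `ℓ - 1 ≤ s`, so both counts are attained after `s` writes. -/
theorem exists_classPairWays_lt {s : ℕ} (hl : 3 ≤ ℓ) (hs : ℓ < s + 2) :
    ∃ c : Fin (ℓ + 1), classPairWays s c < classWays s c ^ 2 := by
  set p : Fin (ℓ + 1) := ⟨ℓ - 1, by omega⟩ with hp
  set q : Fin (ℓ + 1) := ⟨ℓ - 3, by omega⟩ with hq
  have hmp : merge p = p := by
    unfold merge
    rw [if_neg]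
    simp only [hp]
    omega
  have hmq : merge q = p := by
    unfold merge
    rw [if_pos]
    simp only [hq]
    omega
  have hap : (0 : ℝ) < arrivals s p := by
    exact_mod_cast arrivals_pos (show (p : ℕ) ≤ s by simp only [hp]; omega)
  have haq : (0 : ℝ) < arrivals s q := by
    exact_mod_cast arrivals_pos (show (q : ℕ) ≤ s by simp only [hq]; omega)
  refine ⟨p, ?_⟩
  rw [classWays_sq]
  refine Finset.sum_lt_sum (fun i _ => ?_) ⟨p, Finset.mem_univ _, ?_⟩
  · split_ifs with hi
    · exact Finset.sum_le_sum fun i' _ => classPairWays_le_term s p i i' hi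
    · exact le_rfl
  · rw [if_pos hmp, if_pos hmp]
    refine Finset.sum_lt_sum (fun i' _ => classPairWays_le_term s p p i' hmp)
      ⟨q, Finset.mem_univ _, ?_⟩
    rw [if_pos hmq, if_pos hmq]
    refine mul_lt_mul_of_pos_left (pairWays_sq_lt ?_ ?_).1 (mul_pos hap haq)
    · simp only [hp]; omega
    · simp only [hq]; omega

theorem sum_sqrt_classPairWays_lt {s : ℕ} (hl : 3 ≤ ℓ) (hs : ℓ < s + 2) :
    ∑ c : Fin (ℓ + 1), √(classPairWays s c) < ways (s + 2) (0 : Fin (ℓ + 1)) := by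
  rw [← sum_classWays]
  obtain ⟨c, hc⟩ := exists_classPairWays_lt hl hs
  refine Finset.sum_lt_sum (fun c _ => ?_) ⟨c, Finset.mem_univ _, ?_⟩
  · exact Real.sqrt_le_iff.2 ⟨classWays_nonneg _ _, classPairWays_le _ _⟩
  · rw [← Real.sqrt_sq (classWays_nonneg s c)]
    exact Real.sqrt_lt_sqrt (classPairWays_nonneg s c) hc

/-- If the weights `A` are bounded by the numbers of histories, and if `Q` is at most the number
of ways to continue two merged vectors together, then the total weight is exponentially smaller than
the number of all histories. -/
theorem sum_mul_le_of_pairWays (s : ℕ) (A : CountVec n ℓ → ℝ) (Q : ℝ) (hA : ∀ v, 0 ≤ A v)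
    (hQ : 0 ≤ Q) (hAle : ∀ v, A v ≤ ∏ k, (arrivals s (v k) : ℝ))
    (hpair : ∀ v v', A v ≠ 0 → A v' ≠ 0 → (∀ k, merge (v k) = merge (v' k)) →
      Q ≤ ∏ k, pairWays (v k) (v' k)) :
    (∑ v, A v) * Q ≤ (∑ c : Fin (ℓ + 1), √(classPairWays s c)) ^ n := by
  classical
  let cls : CountVec n ℓ → CountVec n ℓ := fun v k => merge (v k)
  have hcls : ∀ c : CountVec n ℓ, (∑ v, if ∀ k, merge (v k) = c k then A v * Q else 0) ≤
      ∏ k, √(classPairWays s (c k)) := by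
    intro c
    -- Squaring turns the sum over one class into a sum over pairs of vectors in it, to which
    -- `hpair` applies; the bounds for the pairs then factorize over the cells.
    refine abs_le_of_sq_le_sq' ?_ (Finset.prod_nonneg fun k _ => Real.sqrt_nonneg _) |>.2
    rw [← Finset.prod_pow]
    simp only [Real.sq_sqrt (classPairWays_nonneg s _)]
    have hprod : ∏ k, classPairWays s (c k) =
        ∑ v : CountVec n ℓ, if ∀ k, merge (v k) = c k then
          (∑ v' : CountVec n ℓ, if ∀ k, merge (v' k) = c k then
            ∏ k, ((arrivals s (v k) : ℝ) * arrivals s (v' k) * pairWays (v k) (v' k) ^ 2) else 0)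
          else 0 := by
      have h1 : ∀ v : CountVec n ℓ, (∑ v' : CountVec n ℓ, if ∀ k, merge (v' k) = c k then
            ∏ k, ((arrivals s (v k) : ℝ) * arrivals s (v' k) * pairWays (v k) (v' k) ^ 2) else 0) =
          ∏ k, ∑ i', if merge i' = c k then
            (arrivals s (v k) : ℝ) * arrivals s i' * pairWays (v k) i' ^ 2 else 0 := fun v =>
        sum_prod_ite (fun k (i' : Fin (ℓ + 1)) => merge i' = c k)
          (fun k i' => (arrivals s (v k) : ℝ) * arrivals s i' * pairWays (v k) i' ^ 2)
      simp only [h1]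
      exact (sum_prod_ite (fun k (i : Fin (ℓ + 1)) => merge i = c k)
        (fun k i => ∑ i', if merge i' = c k then
            (arrivals s i : ℝ) * arrivals s i' * pairWays i i' ^ 2 else 0)).symm
    rw [hprod, sq, Finset.sum_mul_sum]
    refine Finset.sum_le_sum fun v _ => ?_
    split_ifs with hv
    · refine Finset.sum_le_sum fun v' _ => ?_
      split_ifs with hv'
      · rw [Finset.prod_mul_distrib, Finset.prod_mul_distrib, Finset.prod_pow]
        by_cases h0 : A v = 0
        · rw [h0, zero_mul, zero_mul]; positivity
        by_cases h0' : A v' = 0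
        · rw [h0', zero_mul, mul_zero]; positivity
        have hq := hpair v v' h0 h0' fun k => (hv k).trans (hv' k).symm
        calc A v * Q * (A v' * Q) = A v * A v' * Q ^ 2 := by ring
          _ ≤ _ := mul_le_mul (mul_le_mul (hAle v) (hAle v') (hA v') (by positivity))
            (pow_le_pow_left₀ hQ hq 2) (by positivity) (by positivity)
      · rw [mul_zero]
    · simp
  calc (∑ v, A v) * Q = ∑ c : CountVec n ℓ,
        ∑ v, if ∀ k, merge (v k) = c k then A v * Q else 0 := by
        rw [Finset.sum_comm, Finset.sum_mul]
        refine Finset.sum_congr rfl fun v _ => ?_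
        rw [Finset.sum_eq_single (cls v)]
        · rw [if_pos fun _ => rfl]
        · intro c _ hc
          rw [if_neg]
          exact fun h => hc (funext fun k => (h k).symm)
        · exact fun h => (h (Finset.mem_univ _)).elim
    _ ≤ ∑ c : CountVec n ℓ, ∏ k, √(classPairWays s (c k)) := Finset.sum_le_sum fun c _ => hcls c
    _ = _ := by
      rw [← Fin.prod_const n (∑ c : Fin (ℓ + 1), √(classPairWays s c)),
        Finset.prod_univ_sum, Fintype.piFinset_univ]

/-- The first `s` writes are counted by the weights and the last two by pairs of count vectors. The
good messages of the two vectors of a pair may differ, and only those good for both are used; this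
turns `η` into `2 * η`. -/
theorem Code.prod_le_of_informedPartially {s : ℕ} {M : Fin (s + 2) → ℕ}
    (C : Code Info.IP Info.IA n (s + 2) ℓ M) {η ε : ℝ} (hη : 0 < η) (hη1 : η ≤ 1 / 4)
    (hε : (s + 2 : ℕ) * ε < η ^ (s + 2)) (herr : ∀ j, C.errorProb j ≤ ε) :
    ∏ j, ((1 - 2 * η) * M j) ≤ (∑ c : Fin (ℓ + 1), √(classPairWays s c)) ^ n := by
  classical
  obtain ⟨G, h0, hG⟩ := C.exists_good hη (by linarith) hε herr
  have hG' : ∀ j : Fin (s + 2), ∀ v ∈ G j, ∃ B : Finset (Fin (M j)),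
      (∀ m ∈ B, C.Correct j m v ∧ C.next j m v ∈ G (j + 1)) ∧ (1 - η) * M j ≤ B.card :=
    fun j v hv => ⟨_, fun m hm => (Finset.mem_filter.1 hm).2, hG j v hv⟩
  obtain ⟨A, hA0, hAG, hAle, hAsum⟩ :=
    C.exists_prefix_weights (by linarith) h0 hG' s (by omega)
  set a : Fin (s + 2) := (Fin.last s).castSucc with ha
  set b : Fin (s + 2) := Fin.last (s + 1) with hb
  have hM : ∀ j, (0 : ℝ) ≤ M j := fun j => Nat.cast_nonneg _
  have hη2 : 0 ≤ 1 - 2 * η := by linarith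
  have hQ := sum_mul_le_of_pairWays s A ((1 - 2 * η) * M a * ((1 - η) * M b)) hA0
    (mul_nonneg (mul_nonneg hη2 (hM a)) (mul_nonneg (by linarith) (hM b))) hAle (by
      intro v v' hv hv' hm
      have hvG : v ∈ G a := by
        by_contra h
        exact hv (hAG v h)
      have hvG' : v' ∈ G a := by
        by_contra h
        exact hv' (hAG v' h)
      obtain ⟨B, hB, hBc⟩ := hG' a v hvG
      obtain ⟨B', hB', hBc'⟩ := hG' a v' hvG'
      have hcont : ∀ w ∈ G (a + 1), (1 - η) * M b ≤ (successors Set.univ w).card := by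
        intro w hw
        obtain ⟨D, hD, hDc⟩ := hG' b w hw
        exact hDc.trans (by exact_mod_cast C.card_good_le b w D fun m hm => (hD m hm).1)
      have hBB := C.mul_le_prod_pairWays a (fun k => similar_of_merge_eq (hm k)) (B ∩ B')
        ((1 - η) * M b) (fun m hm => (hB m (Finset.mem_inter.1 hm).1).1)
        (fun m hm => hcont _ (hB m (Finset.mem_inter.1 hm).1).2)
        (fun m hm => hcont _ (hB' m (Finset.mem_inter.1 hm).2).2)
      refine le_trans (mul_le_mul_of_nonneg_right ?_ (mul_nonneg (by linarith) (hM b))) hBB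
      have h1 := Finset.card_union_add_card_inter B B'
      have h2 := Finset.card_le_univ (B ∪ B')
      rw [Fintype.card_fin] at h2
      have h3 : (B.card : ℝ) + B'.card ≤ M a + (B ∩ B').card := by
        exact_mod_cast (by omega : B.card + B'.card ≤ M a + (B ∩ B').card)
      linarith)
  refine le_trans ?_ hQ
  rw [Fin.prod_univ_castSucc, Fin.prod_univ_castSucc, mul_assoc]
  refine mul_le_mul (le_trans (Finset.prod_le_prod (fun j _ => mul_nonneg hη2 (hM _))
    fun j _ => ?_) hAsum) ?_ (mul_nonneg (mul_nonneg hη2 (hM _)) (mul_nonneg hη2 (hM _)))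
    (Finset.sum_nonneg fun v _ => hA0 v)
  · exact mul_le_mul_of_nonneg_right (by linarith) (hM _)
  · exact mul_le_mul_of_nonneg_left (mul_le_mul_of_nonneg_right (by linarith) (hM b))
      (mul_nonneg hη2 (hM a))

/-! ### The gap between the sum-rates -/

theorem exists_sumRate_bound (hl : 3 ≤ ℓ) (ht : ℓ < t) :
    ∃ S < Real.logb 2 (ways t (0 : Fin (ℓ + 1))),
      ∀ x ∈ sumRates Info.IP Info.IA ErrorMode.eps t ℓ, x ≤ S := by
  obtain ⟨s, rfl⟩ : ∃ s, t = s + 2 := ⟨t - 2, by omega⟩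
  set L := ∑ c : Fin (ℓ + 1), √(classPairWays s c) with hL
  have hlt : L < ways (s + 2) (0 : Fin (ℓ + 1)) := sum_sqrt_classPairWays_lt hl ht
  have hL0 : 0 ≤ L := Finset.sum_nonneg fun _ _ => Real.sqrt_nonneg _
  have hw : (0 : ℝ) < ways (s + 2) (0 : Fin (ℓ + 1)) := by exact_mod_cast ways_pos _ _
  -- The midpoint is positive, as its logarithm requires, and still strictly below the number of
  -- histories.
  set L' := (L + ways (s + 2) (0 : Fin (ℓ + 1))) / 2 with hL'
  have hL'0 : 0 < L' := by positivity
  refine ⟨Real.logb 2 L', Real.logb_lt_logb one_lt_two hL'0 (by rw [hL']; linarith), ?_⟩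
  rintro _ ⟨R, hR, rfl⟩
  simp only
  refine le_of_forall_pos_le_add fun δ hδ => ?_
  -- Each of the `s + 2` writes loses this amount twice, through `ε` and through `logb 2 (1 - 2 *
  -- η)`.
  have hδ' : 0 < δ / (2 * (s + 2)) := by positivity
  obtain ⟨η, hη, hη4, hlog⟩ := exists_logb_one_sub _ hδ'
  obtain ⟨ε, hε, hεδ, hεη⟩ := exists_pos_mul_lt_pow hη (s + 2) hδ'
  obtain ⟨n, M, C, hn, hC⟩ := hR.2 ε hε
  have hn' : (1 : ℝ) ≤ n := by exact_mod_cast hn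
  have hη1 : 0 < 1 - 2 * η := by linarith
  have hM : ∀ j, (0 : ℝ) < M j := fun j => by exact_mod_cast C.pos j
  have h1 : ∏ j, ((1 - 2 * η) * M j) ≤ L' ^ n :=
    (C.prod_le_of_informedPartially hη hη4 hεη fun j => (hC j).1).trans
      (pow_le_pow_left₀ hL0 (by rw [hL']; linarith) n)
  have h2 := Real.logb_le_logb_of_le one_lt_two
    (Finset.prod_pos fun j _ => mul_pos hη1 (hM j)) h1
  rw [Real.logb_pow, Real.logb_prod _ _ fun j _ => (mul_pos hη1 (hM j)).ne'] at h2
  have h3 : ∀ j, n * (R j - δ / (s + 2)) ≤ Real.logb 2 ((1 - 2 * η) * M j) := by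
    intro j
    rw [Real.logb_mul hη1.ne' (hM j).ne']
    have h4 := (hC j).2
    rw [le_div_iff₀ (by linarith)] at h4
    have h5 : δ / (s + 2) = 2 * (δ / (2 * (s + 2))) := by field_simp
    rw [h5]
    nlinarith
  have h4 := (Finset.sum_le_sum fun j (_ : j ∈ Finset.univ) => h3 j).trans h2
  rw [← Finset.mul_sum, Finset.sum_sub_distrib, Finset.sum_const, Finset.card_univ,
    Fintype.card_fin, nsmul_eq_mul] at h4
  have h5 := le_of_mul_le_mul_left h4 (by linarith)
  have h6 : ((s + 2 : ℕ) : ℝ) * (δ / (s + 2)) = δ := by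
    push_cast
    field_simp
  linarith

end ELM

/-- For `t > ℓ ≥ 3`, the `ε`-error model `EIP:DIA` is strictly worse than every `EIA` model (any
decoder information `Y`, zero-error or `ε`-error). The first two conjuncts say that the maximum
sum-rates really are attained maxima. -/
theorem mainTheorem6 (t ℓ : ℕ) (hl : 3 ≤ ℓ) (ht : ℓ < t) (Y : ELM.Info) (g : ELM.ErrorMode) :
    IsGreatest (ELM.sumRates ELM.Info.IP ELM.Info.IA ELM.ErrorMode.eps t ℓ)
      (ELM.maxSumRate ELM.Info.IP ELM.Info.IA ELM.ErrorMode.eps t ℓ) ∧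
    IsGreatest (ELM.sumRates ELM.Info.IA Y g t ℓ) (ELM.maxSumRate ELM.Info.IA Y g t ℓ) ∧
    ELM.maxSumRate ELM.Info.IP ELM.Info.IA ELM.ErrorMode.eps t ℓ
      < ELM.maxSumRate ELM.Info.IA Y g t ℓ ∧
    ELM.capacityRegion ELM.Info.IP ELM.Info.IA ELM.ErrorMode.eps t ℓ
      ⊂ ELM.capacityRegion ELM.Info.IA Y g t ℓ := by
  have h1 := ELM.isGreatest_maxSumRate (t := t) (ℓ := ℓ) ELM.Info.IP ELM.Info.IA ELM.ErrorMode.eps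
  have h2 := ELM.isGreatest_maxSumRate (t := t) (ℓ := ℓ) ELM.Info.IA Y g
  have hlt : ELM.maxSumRate ELM.Info.IP ELM.Info.IA ELM.ErrorMode.eps t ℓ
      < ELM.maxSumRate ELM.Info.IA Y g t ℓ := by
    obtain ⟨S, hS, hbound⟩ := ELM.exists_sumRate_bound hl ht
    obtain ⟨_, ⟨R, hR, rfl⟩, hx⟩ := ELM.exists_sumRate_ge t ℓ (half_pos (sub_pos.2 hS))
    have h3 := hbound _ h1.1
    have h4 := h2.2 ⟨R, ⟨hR.1, hR.2.ofUninformed⟩, rfl⟩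
    linarith
  refine ⟨h1, h2, hlt, ELM.capacityRegion_subset Y g, fun hsub => ?_⟩
  -- If the regions were equal, a tuple of maximal sum in the larger region would contradict the
  -- strict inequality of the maxima.
  obtain ⟨R, hR, hRmax⟩ := h2.1
  have h3 := h1.2 ⟨R, hsub hR, rfl⟩
  rw [hRmax] at h3
  linarith
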